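/- Let $K$ be a field and let $k \ge 1$. All lattices are finite. A lattice is atomistic if every element is a join of atoms. Let $\mathcal{L}_k$ be the set of isomorphism classes of finite atomistic lattices with exactly $k$ atoms, partially ordered by: $L \ge L'$ if and only if there is a surjective map $\varphi : L \to L'$ with $\varphi(P \vee Q) = \varphi(P) \vee \varphi(Q)$ for all $P, Q \in L$. For a monomial ideal $I$ of a polynomial ring $S = K[X_1,\dots,X_n]$, the lcm-lattice $L_I$ is the set of least common multiples of all finite sets of minimal monomial generators of $I$ (the empty set giving the least element $1$), ordered by divisibility. For a nonzero finitely generated $\mathbb{Z}^n$-graded $S$-module $M$, a Stanley decomposition of $M$ is a finite family of homogeneous elements $\lambda_i \in M$ and subsets $Z_i \subseteq \{X_1,\dots,X_n\}$ such that each $\lambda_i K[Z_i]$ is a free $K[Z_i]$-module with basis $\lambda_i$ and $M = \bigoplus_i \lambda_i K[Z_i]$ as a multigraded $K$-vector space; its depth is $\min_i |Z_i|$. The Stanley depth $\operatorname{sdepth}_S M$ is the maximal depth of a Stanley decomposition of $M$, and $\operatorname{spdim}_S M := n - \operatorname{sdepth}_S M$. Let $\operatorname{pdim}_S M$ denote the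 projective dimension of $M$. Then for every $L \in \mathcal{L}_k$ there are an $n$ and a monomial ideal $I \subset S = K[X_1,\dots,X_n]$ with $L_I \cong L$, and the quantities $$\operatorname{spdim}_1 L := \operatorname{spdim}_S I,\quad \operatorname{spdim}_2 L := \operatorname{spdim}_S S/I,\quad \operatorname{pdim}_1 L := \operatorname{pdim}_S I,\quad \operatorname{pdim}_2 L := \operatorname{pdim}_S S/I$$ are natural numbers which do not depend on the choice of such $n$ and $I$. The resulting functions $\operatorname{spdim}_1, \operatorname{spdim}_2, \operatorname{pdim}_1, \operatorname{pdim}_2 : \mathcal{L}_k \to \mathbb{N}$ are all monotone: if $L \ge L'$ in $\mathcal{L}_k$, then $f(L) \ge f(L')$ for each of these four functions $f$. -/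

import Mathlib

/-! ### Finite atomistic lattices with `k` atoms -/

/-- A finite atomistic lattice with exactly `k` atoms. (A finite lattice has a least element; it is
carried as an `OrderBot` instance, which is unique.) -/
structure AtomisticLattice (k : ℕ) where
  carrier : Type
  [lattice : Lattice carrier]
  [orderBot : OrderBot carrier]
  [finite : Finite carrier]
  [atomistic : IsAtomistic carrier]
  ncard_atoms : {a : carrier | IsAtom a}.ncard = k

attribute [instance] AtomisticLattice.lattice AtomisticLattice.orderBot AtomisticLattice.finite
  AtomisticLattice.atomistic

/-- Isomorphism of lattices. -/
instance AtomisticLattice.setoid (k : ℕ) : Setoid (AtomisticLattice k) where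
  r L L' := Nonempty (L.carrier ≃o L'.carrier)
  iseqv :=
    { refl := fun _ => ⟨OrderIso.refl _⟩
      symm := fun ⟨e⟩ => ⟨e.symm⟩
      trans := fun ⟨e⟩ ⟨f⟩ => ⟨e.trans f⟩ }

/-- The set `𝓛_k` of isomorphism classes of finite atomistic lattices with exactly `k` atoms. -/
def LatticeClass (k : ℕ) : Type 1 := Quotient (AtomisticLattice.setoid k)

/-- The isomorphism class of a lattice. -/
def AtomisticLattice.toClass {k : ℕ} (L : AtomisticLattice k) : LatticeClass k :=
  Quotient.mk _ L

/-- `L.Dominates L'`: there is a surjective join-preserving map `L → L'`. -/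
def AtomisticLattice.Dominates {k : ℕ} (L L' : AtomisticLattice k) : Prop :=
  ∃ φ : L.carrier → L'.carrier, (∀ P Q, φ (P ⊔ Q) = φ P ⊔ φ Q) ∧ Function.Surjective φ

theorem AtomisticLattice.Dominates.trans {k : ℕ} {L₁ L₂ L₃ : AtomisticLattice k}
    (h : L₁.Dominates L₂) (h' : L₂.Dominates L₃) : L₁.Dominates L₃ := by
  obtain ⟨φ, hφ, hs⟩ := h
  obtain ⟨ψ, hψ, hs'⟩ := h'
  exact ⟨ψ ∘ φ, fun P Q => by simp [hφ, hψ], hs'.comp hs⟩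

theorem AtomisticLattice.Dominates.of_equiv {k : ℕ} {L L' : AtomisticLattice k}
    (h : L ≈ L') : L.Dominates L' := by
  obtain ⟨e⟩ := h
  exact ⟨e, fun P Q => map_sup e P Q, e.surjective⟩

theorem AtomisticLattice.Dominates.antisymm {k : ℕ} {L L' : AtomisticLattice k}
    (h : L.Dominates L') (h' : L'.Dominates L) : L ≈ L' := by
  obtain ⟨φ, hφ, hs⟩ := h
  obtain ⟨ψ, -, hs'⟩ := h'
  have hinj : Function.Injective φ :=
    Function.Injective.of_comp (f := ψ) (Finite.injective_iff_surjective.2 (hs'.comp hs))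
  refine ⟨{ Equiv.ofBijective φ ⟨hinj, hs⟩ with map_rel_iff' := ?_ }⟩
  intro a b
  change φ a ≤ φ b ↔ a ≤ b
  rw [← sup_eq_right, ← hφ, hinj.eq_iff, sup_eq_right]

/-- The partial order on `𝓛_k`: `L ≥ L'` if and only if there is a surjective join-preserving map
`L → L'`. -/
instance LatticeClass.partialOrder (k : ℕ) : PartialOrder (LatticeClass k) where
  le x y := Quotient.liftOn₂ y x (fun L L' => L.Dominates L') (by
    intro L₁ L₂ M₁ M₂ h h'
    exact propext ⟨fun H => ((AtomisticLattice.Dominates.of_equiv (Setoid.symm h)).trans H).trans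
      (AtomisticLattice.Dominates.of_equiv h'), fun H =>
      ((AtomisticLattice.Dominates.of_equiv h).trans H).trans
      (AtomisticLattice.Dominates.of_equiv (Setoid.symm h'))⟩)
  le_refl x := by
    induction x using Quotient.inductionOn with
    | h L => exact AtomisticLattice.Dominates.of_equiv (Setoid.refl L)
  le_trans x y z := by
    induction x using Quotient.inductionOn with
    | h L₁ =>
      induction y using Quotient.inductionOn with
      | h L₂ =>
        induction z using Quotient.inductionOn with
        | h L₃ => exact fun h h' => AtomisticLattice.Dominates.trans h' h
  le_antisymm x y := by
    induction x using Quotient.inductionOn with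
    | h L₁ =>
      induction y using Quotient.inductionOn with
      | h L₂ => exact fun h h' => Quotient.sound (AtomisticLattice.Dominates.antisymm h' h)

theorem AtomisticLattice.toClass_le_toClass {k : ℕ} (L L' : AtomisticLattice k) :
    L'.toClass ≤ L.toClass ↔
      ∃ φ : L.carrier → L'.carrier, (∀ P Q, φ (P ⊔ Q) = φ P ⊔ φ Q) ∧ Function.Surjective φ :=
  Iff.rfl

/-! ### Monomial ideals and their lcm-lattices

A monomial in `X_1, …, X_n` is represented by its exponent vector in `Fin n →₀ ℕ`; divisibility is
then `≤` and the least common multiple is `⊔`. -/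

namespace MonomialIdeal

variable {K : Type*} [Field K] {n : ℕ}

/-- `I` is a monomial ideal: it is generated by monomials. -/
def IsMonomial (I : Ideal (MvPolynomial (Fin n) K)) : Prop :=
  ∃ s : Set (Fin n →₀ ℕ), I = Ideal.span ((fun a => MvPolynomial.monomial a (1 : K)) '' s)

/-- The minimal monomial generators of a monomial ideal: the monomials in `I` that are minimal with
respect to divisibility. -/
def minGens (I : Ideal (MvPolynomial (Fin n) K)) : Set (Fin n →₀ ℕ) :=
  {a | Minimal (fun b => MvPolynomial.monomial b (1 : K) ∈ I) a}

/-- The lcm-lattice of `I`: all least common multiples of finite sets of minimal generators, ordered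
by divisibility. The least element is the monomial `1`, the lcm of the empty set. -/
def lcmLattice (I : Ideal (MvPolynomial (Fin n) K)) : Set (Fin n →₀ ℕ) :=
  {m | ∃ t : Finset (Fin n →₀ ℕ), (t : Set (Fin n →₀ ℕ)) ⊆ minGens I ∧ m = t.sup id}

/-- `I` is a monomial ideal whose lcm-lattice is isomorphic to `L`. -/
def Realizes {k : ℕ} (I : Ideal (MvPolynomial (Fin n) K)) (L : AtomisticLattice k) : Prop :=
  IsMonomial I ∧ Nonempty (lcmLattice I ≃o L.carrier)

end MonomialIdeal

/-! ### Stanley depth of multigraded modules -/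

section Stanley

variable {K : Type*} [Field K] {n : ℕ} {M : Type*} [AddCommGroup M]
  [Module (MvPolynomial (Fin n) K) M] [Module K M] [IsScalarTower K (MvPolynomial (Fin n) K) M]

/-- The subspace `x K[Z]` of `M`. -/
noncomputable def stanleySpace (Z : Finset (Fin n)) (x : M) : Submodule K M :=
  (Subalgebra.toSubmodule (MvPolynomial.supported K (Z : Set (Fin n)))).map
    ((LinearMap.toSpanSingleton (MvPolynomial (Fin n) K) M x).restrictScalars K)

/-- A Stanley decomposition of a `ℤⁿ`-graded module `M` with homogeneous components `ℳ a`: finitely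
many homogeneous elements `x_i` and sets `Z_i` of variables such that `x_i K[Z_i]` is free over
`K[Z_i]` with basis `x_i`, and `M` is the direct sum of the `x_i K[Z_i]` as a `K`-vector space.
(The sum respects the multigrading because the `x_i` are homogeneous.) -/
structure StanleyDecomposition (ℳ : (Fin n → ℤ) → Submodule K M) where
  r : ℕ
  Z : Fin r → Finset (Fin n)
  x : Fin r → M
  homogeneous : ∀ i, ∃ a, x i ∈ ℳ a
  free : ∀ i, Function.Injective
    (fun f : MvPolynomial.supported K (Z i : Set (Fin n)) => (f : MvPolynomial (Fin n) K) • x i)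
  isInternal : DirectSum.IsInternal (fun i => stanleySpace (K := K) (Z i) (x i))

/-- The depth of a Stanley decomposition: the least number of variables in one of the `Z_i`, which
is the depth of the module `⨁ x_i K[Z_i]` (with value `⊤` for the zero module). -/
noncomputable def StanleyDecomposition.depth {ℳ : (Fin n → ℤ) → Submodule K M}
    (D : StanleyDecomposition ℳ) : ℕ∞ :=
  ⨅ i, ((D.Z i).card : ℕ∞)

/-- The Stanley depth: the largest depth of a Stanley decomposition. -/
noncomputable def stanleyDepth (ℳ : (Fin n → ℤ) → Submodule K M) : ℕ∞ :=
  ⨆ D : StanleyDecomposition ℳ, D.depth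

/-- The Stanley projective dimension `n - sdepth M`. For `M ≠ 0` the subtraction is not truncated,
by `stanleyDepth_le`. -/
noncomputable def stanleyProjDim (ℳ : (Fin n → ℤ) → Submodule K M) : ℕ∞ :=
  (n : ℕ∞) - stanleyDepth ℳ

theorem stanleyDepth_le [Nontrivial M] (ℳ : (Fin n → ℤ) → Submodule K M) :
    stanleyDepth ℳ ≤ n := by
  refine iSup_le fun D => ?_
  have hr : Nonempty (Fin D.r) := by
    by_contra h
    rw [not_nonempty_iff] at h
    have h1 := D.isInternal.submodule_iSup_eq_top
    rw [iSup_of_empty] at h1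
    exact bot_ne_top h1
  obtain ⟨i⟩ := hr
  refine (iInf_le _ i).trans ?_
  exact_mod_cast (Finset.card_le_univ (D.Z i)).trans_eq (Fintype.card_fin n)

/-- The component of multidegree `a ∈ ℤⁿ` of `K[X_1, …, X_n]`. -/
noncomputable def polyComponent (K : Type*) [Field K] {n : ℕ} (a : Fin n → ℤ) :
    Submodule K (MvPolynomial (Fin n) K) :=
  Submodule.span K
    {f | ∃ m : Fin n →₀ ℕ, (∀ i, (m i : ℤ) = a i) ∧ f = MvPolynomial.monomial m 1}

/-- The multigrading of an ideal `I` induced from the polynomial ring. -/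
noncomputable def idealGrading (I : Ideal (MvPolynomial (Fin n) K)) (a : Fin n → ℤ) :
    Submodule K I :=
  (polyComponent K a).comap (I.subtype.restrictScalars K)

/-- The multigrading of the quotient `S/I` induced from the polynomial ring. -/
noncomputable def quotientGrading (I : Ideal (MvPolynomial (Fin n) K)) (a : Fin n → ℤ) :
    Submodule K (MvPolynomial (Fin n) K ⧸ I) :=
  (polyComponent K a).map (Ideal.Quotient.mkₐ K I).toLinearMap

end Stanley

/-! ### The four invariants of a monomial ideal -/

namespace MonomialIdeal

variable {K : Type*} [Field K] {n : ℕ}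

/-- The Stanley projective dimension of `I`. -/
noncomputable def spdimIdeal (I : Ideal (MvPolynomial (Fin n) K)) : ℕ∞ :=
  stanleyProjDim (idealGrading I)

/-- The Stanley projective dimension of `S/I`. -/
noncomputable def spdimQuotient (I : Ideal (MvPolynomial (Fin n) K)) : ℕ∞ :=
  stanleyProjDim (quotientGrading I)

/-- The projective dimension of the `S`-module `I`. -/
noncomputable def pdimIdeal (I : Ideal (MvPolynomial (Fin n) K)) : WithBot ℕ∞ :=
  CategoryTheory.projectiveDimension (ModuleCat.of (MvPolynomial (Fin n) K) I)

/-- The projective dimension of the `S`-module `S/I`. -/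
noncomputable def pdimQuotient (I : Ideal (MvPolynomial (Fin n) K)) : WithBot ℕ∞ :=
  CategoryTheory.projectiveDimension
    (ModuleCat.of (MvPolynomial (Fin n) K) (MvPolynomial (Fin n) K ⧸ I))

end MonomialIdeal

/-!
# Stanley projective dimension and projective dimension are monotone on lcm-lattices

Let `I ⊆ S = K[X_1, …, X_n]` and `J ⊆ S' = K[Y_1, …, Y_m]` be monomial ideals and let `L_I → L_J`
be a join-preserving surjection between their lcm-lattices, which have equally many atoms. All four
inequalities come from one map of exponent vectors `θ : ℕ^m → ℕ^n` with two properties: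

* the preimage of a principal filter is empty or a principal filter (`IsPartiallyResiduated`);
* the preimage of the set of exponents of `I` is the set of exponents of `J`.

The map is the upper adjoint of a partial join-preserving map `ℕ^n → ℕ^m` sending the `i`-th
generator of `I` to its image in `L_J`; such a map is determined by its restrictions to the `n`
coordinate axes, and for these one takes the largest possible values. That the generators go where
they should is exactly what compatibility with joins provides (`exists_isPartiallyResiduated`).
Counting atoms shows that no generator of `I` is sent to `1`, whence the second property
(`MonomialIdeal.exists_isPartiallyResiduated_of_dominates`).

*Stanley depth.* A Stanley decomposition of `I` or of `S/I` amounts to a partition of the set of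
exponents of `I`, or of its complement, into cells `a + ℕ^Z`
(`IsMonomialBasis.exists_stanleyDecomposition_iff`). A cell is the filter of `a` without the filters
of `a + e_j`, `j ∉ Z`. Hence its preimage under `θ` is empty or a principal filter of `ℕ^m` without
at most `n - |Z|` principal filters, and such a set can be partitioned into cells of codimension at
most `n - |Z|` (`HasStanleyPartition.cell_diff`, `HasStanleyPartition.preimage`).

*Projective dimension.* A graded submodule of a graded free module is a monotone family of subspaces
`N a` of a vector space (`familyModule`), and `N ∘ θ` is such a family over `S'`. This pullback is
exact, takes graded free modules to graded free modules by the first property of `θ`, and takes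
projective modules to projective modules because a projective graded module is a graded direct
summand of a graded free one. By dimension shifting it does not increase the projective dimension
(`hasProjectiveDimensionLT_familyModule_comp`), and it takes `I` to `J`. As `S/I` is not projective,
its projective dimension is that of `I` plus one. Finiteness follows by induction on the number of
generators (`MonomialIdeal.hasProjectiveDimensionLT_span_monomial`).

Applied in both directions to an isomorphism of lattices, the inequalities show that the invariants
depend on the lattice only (`MonomialIdeal.exists_latticeClass_function`). An ideal with a given
lcm-lattice is constructed in `MonomialIdeal.exists_realizes`.
-/

/-! ### Maps of exponent vectors whose preimages of principal filters are principal -/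

/-- A map between sets of exponent vectors is *partially residuated* if the preimage of every
principal filter is empty or a principal filter. It is then the upper adjoint of a partially defined
join-preserving map. -/
def IsPartiallyResiduated {m n : ℕ} (θ : (Fin m →₀ ℕ) → (Fin n →₀ ℕ)) : Prop :=
  ∀ a, θ ⁻¹' Set.Ici a = ∅ ∨ ∃ b, θ ⁻¹' Set.Ici a = Set.Ici b

theorem IsPartiallyResiduated.monotone {m n : ℕ} {θ : (Fin m →₀ ℕ) → (Fin n →₀ ℕ)}
    (h : IsPartiallyResiduated θ) : Monotone θ := by
  intro b b' hb
  have hmem : b ∈ θ ⁻¹' Set.Ici (θ b) := le_refl (θ b)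
  obtain h0 | ⟨c, hc⟩ := h (θ b)
  · rw [h0] at hmem
    exact hmem.elim
  · rw [hc] at hmem
    have : b' ∈ θ ⁻¹' Set.Ici (θ b) := hc ▸ (le_trans hmem hb : b' ∈ Set.Ici c)
    exact this

theorem isPartiallyResiduated_id (n : ℕ) :
    IsPartiallyResiduated (id : (Fin n →₀ ℕ) → (Fin n →₀ ℕ)) :=
  fun a => Or.inr ⟨a, rfl⟩

/-- It suffices to consider the filters given by a lower bound for one coordinate, as intersections of
principal filters are principal. -/
theorem isPartiallyResiduated_of_coord {m n : ℕ} {θ : (Fin m →₀ ℕ) → (Fin n →₀ ℕ)}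
    (h : ∀ (j : Fin n) (c : ℕ), {b | c ≤ θ b j} = ∅ ∨ ∃ b₀, {b | c ≤ θ b j} = Set.Ici b₀) :
    IsPartiallyResiduated θ := by
  intro a
  have hpre : θ ⁻¹' Set.Ici a = ⋂ j, {b | a j ≤ θ b j} := by
    ext b
    simp [Finsupp.le_def]
  by_cases hemp : ∃ j, {b | a j ≤ θ b j} = ∅
  · obtain ⟨j, hj⟩ := hemp
    left
    rw [hpre, Set.eq_empty_iff_forall_notMem]
    intro b hb
    have := Set.mem_iInter.1 hb j
    rw [hj] at this
    exact this
  · push Not at hemp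
    have hex : ∀ j, ∃ b₀, {b | a j ≤ θ b j} = Set.Ici b₀ := fun j =>
      (h j (a j)).resolve_left (hemp j).ne_empty
    choose β hβ using hex
    refine Or.inr ⟨Finset.univ.sup β, ?_⟩
    rw [hpre]
    ext b
    simp [hβ]

/-- If sending the generators `g i` to `g' i` is compatible with all relations between joins, there is a
partially residuated map under which `g i` and `g' i` generate corresponding filters. Its `j`-th
coordinate at `b` is the largest `c` such that `b` lies above the (componentwise) meet of all `g' l`
with `c ≤ g l j`. -/
theorem exists_isPartiallyResiduated {m n : ℕ} {ι : Type*} [Finite ι] (g : ι → Fin n →₀ ℕ)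
    (g' : ι → Fin m →₀ ℕ)
    (H : ∀ (i : ι) (T : Finset ι), g i ≤ T.sup g → g' i ≤ T.sup g') :
    ∃ θ : (Fin m →₀ ℕ) → (Fin n →₀ ℕ), IsPartiallyResiduated θ ∧
      ∀ i, θ ⁻¹' Set.Ici (g i) = Set.Ici (g' i) := by
  classical
  have := Fintype.ofFinite ι
  -- `P j c b` says that the `j`-th coordinate of `θ b` is to be at least `c`: either `c = 0`, or the
  -- meet of the nonempty family of all `g' l` with `c ≤ g l j` lies below `b`.
  let P : Fin n → ℕ → (Fin m →₀ ℕ) → Prop := fun j c b =>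
    c = 0 ∨ (∃ l, c ≤ g l j) ∧ ∀ y, ∃ l, c ≤ g l j ∧ g' l y ≤ b y
  have hbdd : ∀ j b, BddAbove {c | P j c b} := by
    intro j b
    refine ⟨(Finset.univ.sup g) j, ?_⟩
    rintro c (rfl | ⟨⟨l, hl⟩, -⟩)
    · exact Nat.zero_le _
    · exact hl.trans (Finset.le_sup (f := g) (Finset.mem_univ l) j)
  let θ : (Fin m →₀ ℕ) → (Fin n →₀ ℕ) := fun b =>
    Finsupp.equivFunOnFinite.symm fun j => sSup {c | P j c b}
  have hθ : ∀ j c b, c ≤ θ b j ↔ P j c b := by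
    intro j c b
    have hmem : P j (θ b j) b := Nat.sSup_mem (s := {c | P j c b}) ⟨0, Or.inl rfl⟩ (hbdd j b)
    constructor
    · intro hc
      rcases hmem with h0 | ⟨⟨l, hl⟩, h2⟩
      · exact Or.inl (by omega)
      · refine Or.inr ⟨⟨l, hc.trans hl⟩, fun y => ?_⟩
        obtain ⟨l', h3, h4⟩ := h2 y
        exact ⟨l', hc.trans h3, h4⟩
    · intro hc
      exact le_csSup (hbdd j b) hc
  refine ⟨θ, isPartiallyResiduated_of_coord fun j c => ?_, fun i => ?_⟩
  · simp only [hθ]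
    rcases Nat.eq_zero_or_pos c with rfl | hc
    · exact Or.inr ⟨0, by ext b; simp [P]⟩
    by_cases hl : ∃ l, c ≤ g l j
    · refine Or.inr ⟨Finsupp.equivFunOnFinite.symm fun y => sInf {d | ∃ l, c ≤ g l j ∧ g' l y = d},
        ?_⟩
      ext b
      simp only [P, hl, hc.ne', false_or, true_and, Set.mem_ofPred_eq, Set.mem_Ici, Finsupp.le_def,
        Finsupp.equivFunOnFinite_symm_apply_apply]
      refine forall_congr' fun y => ⟨?_, fun h => ?_⟩
      · rintro ⟨l, h1, h2⟩
        exact le_trans (Nat.sInf_le (Exists.intro l ⟨h1, rfl⟩)) h2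
      · obtain ⟨l, h1⟩ := hl
        obtain ⟨l', h2, h3⟩ := Nat.sInf_mem (s := {d | ∃ l, c ≤ g l j ∧ g' l y = d})
          ⟨_, l, h1, rfl⟩
        exact ⟨l', h2, h3.trans_le h⟩
    · left
      ext b
      simp [P, hl, hc.ne']
  · ext b
    simp only [Set.mem_preimage, Set.mem_Ici]
    constructor
    · intro hb y
      by_contra! hlt
      -- Among the generators with smaller `y`-degree the join has smaller `y`-degree as well, so
      -- `H` provides a coordinate `j` in which `g i` exceeds all of them.
      let T : Finset ι := Finset.univ.filter fun l => g' l y < g' i y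
      have hT : (T.sup g') y < g' i y := by
        have : ∀ U : Finset ι, U ⊆ T → (U.sup g') y < g' i y := by
          intro U
          induction U using Finset.induction_on with
          | empty => intro _; exact (Nat.zero_le _).trans_lt hlt
          | insert l U _ ih =>
            intro hU
            rw [Finset.sup_insert, Finsupp.sup_apply]
            exact max_lt (Finset.mem_filter.1 (hU (Finset.mem_insert_self l U))).2
              (ih ((Finset.subset_insert l U).trans hU))
        exact this T subset_rfl
      have hnot : ¬ g i ≤ T.sup g := fun h => absurd (H i T h y) (not_le.2 hT)
      rw [Finsupp.le_def] at hnot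
      push Not at hnot
      obtain ⟨j, hj⟩ := hnot
      rcases (hθ j (g i j) b).1 (hb j) with h0 | ⟨-, h2⟩
      · omega
      · obtain ⟨l, h3, h4⟩ := h2 y
        have hl : l ∈ T := Finset.mem_filter.2 ⟨Finset.mem_univ l, h4.trans_lt hlt⟩
        have := Finset.le_sup (f := g) hl j
        omega
    · intro hb j
      rw [hθ]
      exact Or.inr ⟨⟨i, le_rfl⟩, fun y => ⟨i, le_rfl, hb y⟩⟩

/-! ### Stanley partitions of sets of exponent vectors -/

/-- The exponent vectors of the monomials in `x^a K[Z]`. -/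
def stanleyCell {n : ℕ} (a : Fin n →₀ ℕ) (Z : Finset (Fin n)) : Set (Fin n →₀ ℕ) :=
  {b | a ≤ b ∧ ∀ j, j ∉ Z → b j = a j}

/-- `A` is a finite disjoint union of cells `a + ℕ^Z` with `n - |Z| ≤ c`. -/
def HasStanleyPartition {n : ℕ} (c : ℕ) (A : Set (Fin n →₀ ℕ)) : Prop :=
  ∃ (ι : Type) (_ : Finite ι) (a : ι → Fin n →₀ ℕ) (Z : ι → Finset (Fin n)),
    (∀ i, n ≤ (Z i).card + c) ∧ Pairwise (Function.onFun Disjoint fun i => stanleyCell (a i) (Z i)) ∧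
    ⋃ i, stanleyCell (a i) (Z i) = A

theorem HasStanleyPartition.cell {n c : ℕ} (a : Fin n →₀ ℕ) (Z : Finset (Fin n))
    (h : n ≤ Z.card + c) : HasStanleyPartition c (stanleyCell a Z) :=
  ⟨Unit, inferInstance, fun _ => a, fun _ => Z, fun _ => h,
    fun i j hij => (hij (Subsingleton.elim i j)).elim, Set.iUnion_const _⟩

theorem HasStanleyPartition.empty {n : ℕ} (c : ℕ) :
    HasStanleyPartition c (∅ : Set (Fin n →₀ ℕ)) :=
  ⟨Empty, inferInstance, Empty.elim, Empty.elim, fun i => i.elim, fun i => i.elim,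
    Set.iUnion_of_empty _⟩

theorem HasStanleyPartition.iUnion {n c : ℕ} {κ : Type} [Finite κ] {A : κ → Set (Fin n →₀ ℕ)}
    (hd : Pairwise (Function.onFun Disjoint A)) (h : ∀ k, HasStanleyPartition c (A k)) :
    HasStanleyPartition c (⋃ k, A k) := by
  choose ι hι a Z hZ hp hu using h
  refine ⟨Σ k, ι k, inferInstance, fun p => a p.1 p.2, fun p => Z p.1 p.2, fun p => hZ p.1 p.2,
    ?_, ?_⟩
  · rintro ⟨k, i⟩ ⟨k', i'⟩ hne
    by_cases hk : k = k'
    · subst hk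
      exact hp k fun h : i = i' => hne (by rw [h])
    · refine (hd hk).mono ?_ ?_
      · rw [← hu k]
        exact Set.subset_iUnion (fun i => stanleyCell (a k i) (Z k i)) i
      · rw [← hu k']
        exact Set.subset_iUnion (fun i => stanleyCell (a k' i) (Z k' i)) i'
  · rw [Set.iUnion_sigma]
    exact Set.iUnion_congr hu

/-- Removing `s.card` principal filters from a cell costs at most `s.card` dimensions: a vector of
the cell that is not above `u` is sorted by the first coordinate `j` in which it lies below `u` and
by its value there, and each of these pieces is a cell with one free coordinate less. -/
theorem HasStanleyPartition.cell_diff {n c : ℕ} (s : Finset (Fin n →₀ ℕ)) :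
    ∀ (a : Fin n →₀ ℕ) (Z : Finset (Fin n)), n + s.card ≤ Z.card + c →
      HasStanleyPartition c (stanleyCell a Z \ ⋃ u ∈ s, Set.Ici u) := by
  classical
  induction s using Finset.induction_on with
  | empty =>
    intro a Z h
    simpa using HasStanleyPartition.cell a Z (by simpa using h)
  | insert u s hu ih =>
    intro a Z h
    rw [Finset.card_insert_of_notMem hu] at h
    -- If a fixed coordinate is too small, no vector of the cell lies above `u`.
    by_cases hbad : ∃ j, j ∉ Z ∧ a j < u j
    · obtain ⟨j, hj, hju⟩ := hbad
      have : stanleyCell a Z \ ⋃ v ∈ insert u s, Set.Ici v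
          = stanleyCell a Z \ ⋃ v ∈ s, Set.Ici v := by
        ext b
        simp only [Set.mem_sdiff, Set.mem_iUnion, Finset.mem_insert, Set.mem_Ici, exists_prop,
          not_exists, not_and]
        refine and_congr_right fun hb => ⟨fun h v hv => h v (Or.inr hv), fun h v hv => ?_⟩
        rcases hv with rfl | hv
        · intro hle
          have := hle j
          rw [hb.2 j hj] at this
          omega
        · exact h v hv
      rw [this]
      exact ih a Z (by omega)
    · push Not at hbad
      -- The pieces: the first coordinate `j` below `u`, and the value there.
      let κ := {p : Fin n × ℕ // p.1 ∈ Z ∧ p.2 ∈ Finset.Ico (a p.1) (u p.1)}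
      have : Finite κ := Finite.of_injective
        (fun p : κ => (⟨p.1.1, p.1.2, p.2.2⟩ : Σ j : Fin n, Finset.Ico (a j) (u j))) (by
          rintro ⟨⟨j, t⟩, hp⟩ ⟨⟨j', t'⟩, hp'⟩ he
          obtain ⟨rfl, he⟩ := Sigma.mk.inj_iff.1 he
          simp only [heq_eq_eq, Subtype.mk.injEq] at he
          subst he
          rfl)
      let α : κ → Fin n →₀ ℕ := fun p => Finsupp.equivFunOnFinite.symm fun i =>
        if i < p.1.1 then max (a i) (u i) else if i = p.1.1 then p.1.2 else a i
      have hα : ∀ p i, α p i =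
          if i < p.1.1 then max (a i) (u i) else if i = p.1.1 then p.1.2 else a i :=
        fun _ _ => rfl
      have hmem : ∀ p b, b ∈ stanleyCell (α p) (Z.erase p.1.1) ↔
          b ∈ stanleyCell a Z ∧ b p.1.1 = p.1.2 ∧ ∀ i < p.1.1, u i ≤ b i := by
        rintro ⟨⟨j, t⟩, hj, ht⟩ b
        simp only [Finset.mem_Ico] at hj ht
        simp only [stanleyCell, Set.mem_ofPred_eq, Finsupp.le_def, hα, Finset.mem_erase]
        constructor
        · rintro ⟨h1, h2⟩
          have hbj : b j = t := by simpa using h2 j (by simp)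
          refine ⟨⟨fun i => ?_, fun i hi => ?_⟩, hbj, fun i hi => ?_⟩
          · have := h1 i
            split_ifs at this with h3 h4
            · omega
            · subst h4; omega
            · exact this
          · have := h2 i (by simp [hi])
            have hau := hbad i hi
            split_ifs at this with h3 h4
            · omega
            · subst h4; exact (hi hj).elim
            · exact this
          · have := h1 i
            rw [if_pos hi] at this
            omega
        · rintro ⟨⟨h1, h2⟩, h3, h4⟩
          refine ⟨fun i => ?_, fun i hi => ?_⟩
          · split_ifs with h5 h6
            · exact max_le (h1 i) (h4 i h5)
            · subst h6; omega
            · exact h1 i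
          · split_ifs with h5 h6
            · have hiZ : i ∉ Z := fun hiZ => hi ⟨h5.ne, hiZ⟩
              have hau := hbad i hiZ
              have := h2 i hiZ
              omega
            · subst h6; omega
            · exact h2 i fun hiZ => hi ⟨h6, hiZ⟩
      have hunion : stanleyCell a Z \ ⋃ v ∈ insert u s, Set.Ici v
          = ⋃ p : κ, stanleyCell (α p) (Z.erase p.1.1) \ ⋃ v ∈ s, Set.Ici v := by
        rw [← Set.iUnion_sdiff, Finset.set_biUnion_insert, ← Set.sdiff_sdiff]
        congr 1
        ext b
        simp only [Set.mem_sdiff, Set.mem_Ici, Set.mem_iUnion, hmem]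
        constructor
        · rintro ⟨hb, hub⟩
          have hne : (Finset.univ.filter fun j => b j < u j).Nonempty := by
            rw [Finsupp.le_def] at hub
            push Not at hub
            obtain ⟨j, hj⟩ := hub
            exact ⟨j, by simpa using hj⟩
          obtain ⟨j, hj, hmin⟩ := Finset.exists_min_image _ id hne
          rw [Finset.mem_filter] at hj
          have hjZ : j ∈ Z := by
            by_contra hjZ
            have := hbad j hjZ
            have := hb.2 j hjZ
            omega
          refine ⟨⟨(j, b j), hjZ, Finset.mem_Ico.2 ⟨hb.1 j, hj.2⟩⟩, hb, rfl, fun i hi => ?_⟩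
          by_contra! hlt
          exact absurd (hmin i (Finset.mem_filter.2 ⟨Finset.mem_univ i, hlt⟩)) (not_le.2 hi)
        · rintro ⟨⟨⟨j, t⟩, hj, ht⟩, hb, h2, -⟩
          refine ⟨hb, fun hle => ?_⟩
          have := hle j
          have := (Finset.mem_Ico.1 ht).2
          simp only at h2 this
          omega
      rw [hunion]
      refine HasStanleyPartition.iUnion ?_ fun p => ih _ _ ?_
      · rintro p q hpq
        refine Disjoint.mono Set.sdiff_subset Set.sdiff_subset (Set.disjoint_left.2 fun b hb hb' => ?_)
        rw [hmem] at hb hb'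
        have hp := (Finset.mem_Ico.1 p.2.2).2
        have hq := (Finset.mem_Ico.1 q.2.2).2
        rcases lt_trichotomy p.1.1 q.1.1 with hlt | heq | hlt
        · have := hb'.2.2 _ hlt
          omega
        · refine hpq (Subtype.ext (Prod.ext heq ?_))
          rw [← hb.2.1, ← hb'.2.1, heq]
        · have := hb.2.2 _ hlt
          omega
      · rw [Finset.card_erase_of_mem p.2.1]
        have := Finset.card_pos.2 ⟨_, p.2.1⟩
        omega

theorem stanleyCell_univ {n : ℕ} (a : Fin n →₀ ℕ) :
    stanleyCell a Finset.univ = Set.Ici a := by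
  ext b
  simp [stanleyCell]

theorem HasStanleyPartition.Ici_diff {n c : ℕ} (b : Fin n →₀ ℕ) (s : Finset (Fin n →₀ ℕ))
    (h : s.card ≤ c) : HasStanleyPartition c (Set.Ici b \ ⋃ u ∈ s, Set.Ici u) := by
  rw [← stanleyCell_univ]
  exact HasStanleyPartition.cell_diff s b _ (by simpa using h)

/-- Stanley partitions can be pulled back along partially residuated maps without increasing the
codimension. -/
theorem HasStanleyPartition.preimage {m n c : ℕ} {θ : (Fin m →₀ ℕ) → (Fin n →₀ ℕ)}
    (hθ : IsPartiallyResiduated θ) {A : Set (Fin n →₀ ℕ)} (hA : HasStanleyPartition c A) :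
    HasStanleyPartition c (θ ⁻¹' A) := by
  classical
  obtain ⟨ι, hι, a, Z, hZ, hp, rfl⟩ := hA
  rw [Set.preimage_iUnion]
  refine HasStanleyPartition.iUnion (fun i j hij => (hp hij).preimage θ) fun i => ?_
  -- The cell is `Ici a` without the filters generated by `a + e_j`, `j ∉ Z`.
  have hcell : stanleyCell (a i) (Z i) =
      Set.Ici (a i) \ ⋃ j : {j // j ∉ Z i}, Set.Ici (a i + Finsupp.single j.1 1) := by
    ext b
    simp only [stanleyCell, Set.mem_ofPred_eq, Set.mem_sdiff, Set.mem_Ici, Set.mem_iUnion,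
      Subtype.exists, exists_prop, not_exists, not_and]
    refine and_congr_right fun hb => forall₂_congr fun j _ => ⟨fun h hle => ?_, fun h => ?_⟩
    · have := hle j
      simp only [Finsupp.add_apply, Finsupp.single_eq_same] at this
      omega
    · by_contra hne
      refine h fun l => ?_
      have := hb l
      by_cases hl : l = j
      · subst hl
        simp only [Finsupp.add_apply, Finsupp.single_eq_same]
        omega
      · simpa [Finsupp.single_apply, Ne.symm hl] using this
  rw [hcell, Set.preimage_sdiff, Set.preimage_iUnion]
  obtain h0 | ⟨b, hb⟩ := hθ (a i)
  · rw [h0, Set.empty_sdiff]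
    exact HasStanleyPartition.empty c
  have hex : ∀ j : {j // j ∉ Z i}, ∃ s : Finset (Fin m →₀ ℕ), s.card ≤ 1 ∧
      θ ⁻¹' Set.Ici (a i + Finsupp.single j.1 1) = ⋃ u ∈ s, Set.Ici u := by
    intro j
    obtain h0 | ⟨u, hu⟩ := hθ (a i + Finsupp.single j.1 1)
    · exact ⟨∅, by simp, by simp [h0]⟩
    · exact ⟨{u}, by simp, by simp [hu]⟩
  choose s hs hsu using hex
  have hun : ⋃ j : {j // j ∉ Z i}, θ ⁻¹' Set.Ici (a i + Finsupp.single j.1 1)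
      = ⋃ u ∈ Finset.univ.biUnion s, Set.Ici u := by
    simp_rw [hsu]
    ext b
    simp only [Set.mem_iUnion, Finset.mem_biUnion, Finset.mem_univ, true_and, exists_prop]
    exact ⟨fun ⟨j, u, h1, h2⟩ => ⟨u, ⟨j, h1⟩, h2⟩, fun ⟨u, ⟨j, h1⟩, h2⟩ => ⟨j, u, h1, h2⟩⟩
  rw [hb, hun]
  refine HasStanleyPartition.Ici_diff b _ (Finset.card_biUnion_le.trans ?_)
  refine (Finset.sum_le_sum fun j _ => hs j).trans ?_
  have hcard : Fintype.card {j // j ∉ Z i} = n - (Z i).card := by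
    rw [Fintype.card_subtype_compl, Fintype.card_fin, Fintype.card_coe]
  have := hZ i
  rw [Finset.sum_const, Finset.card_univ, hcard]
  simp only [smul_eq_mul, mul_one]
  omega

theorem HasStanleyPartition.compl_biUnion_Ici {n : ℕ} (s : Finset (Fin n →₀ ℕ)) :
    HasStanleyPartition s.card (⋃ u ∈ s, Set.Ici u)ᶜ := by
  have := HasStanleyPartition.Ici_diff 0 s le_rfl
  rwa [show Set.Ici (0 : Fin n →₀ ℕ) = Set.univ from Set.eq_univ_of_forall fun b => (zero_le : 0 ≤ b),
    ← Set.compl_eq_univ_sdiff] at this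

/-- The filters are split off one at a time, each without those that come before it. -/
theorem HasStanleyPartition.biUnion_Ici {n : ℕ} (s : Finset (Fin n →₀ ℕ)) :
    HasStanleyPartition s.card (⋃ u ∈ s, Set.Ici u) := by
  classical
  induction s using Finset.induction_on with
  | empty => simpa using HasStanleyPartition.empty 0
  | insert u s hu ih =>
    rw [Finset.card_insert_of_notMem hu]
    have h1 := HasStanleyPartition.Ici_diff u s (Nat.le_succ _)
    have h2 : HasStanleyPartition (s.card + 1) (⋃ u ∈ s, Set.Ici u) := by
      obtain ⟨ι, hι, a, Z, hZ, h⟩ := ih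
      exact ⟨ι, hι, a, Z, fun i => (hZ i).trans (by omega), h⟩
    have := HasStanleyPartition.iUnion (κ := Bool)
      (A := fun k => cond k (Set.Ici u \ ⋃ u ∈ s, Set.Ici u) (⋃ u ∈ s, Set.Ici u)) (c := s.card + 1)
      (by
        rintro (_ | _) (_ | _) hne
        · exact (hne rfl).elim
        · exact Set.disjoint_sdiff_right
        · exact Set.disjoint_sdiff_left
        · exact (hne rfl).elim)
      (by rintro (_ | _) <;> assumption)
    rw [Finset.set_biUnion_insert]
    convert this using 1
    ext b
    by_cases hb : u ≤ b <;> by_cases hs : ∃ i ∈ s, i ≤ b <;> simp_all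

/-! ### Stanley decompositions of modules with a monomial basis -/

theorem LinearIndepOn.iSupIndep_span {K V α ι : Type*} [DivisionRing K] [AddCommGroup V]
    [Module K V] {E : α → V} {A : Set α} (h : LinearIndepOn K E A) {C : ι → Set α}
    (hC : ∀ i, C i ⊆ A) (hd : Pairwise (Function.onFun Disjoint C)) :
    iSupIndep fun i => Submodule.span K (E '' C i) := by
  intro i
  simp_rw [← Submodule.span_iUnion, ← Set.image_iUnion]
  have hdisj : Disjoint (C i) (⋃ j, ⋃ (_ : j ≠ i), C j) := by
    simp only [Set.disjoint_iUnion_right]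
    exact fun j hj => hd hj.symm
  refine ((linearIndepOn_union_iff hdisj).1 (h.mono ?_)).2.2
  exact Set.union_subset (hC i) (Set.iUnion₂_subset fun j _ => hC j)

section MonomialBasis

variable {K : Type*} [Field K] {n : ℕ} {M : Type*} [AddCommGroup M]
  [Module (MvPolynomial (Fin n) K) M] [Module K M] [IsScalarTower K (MvPolynomial (Fin n) K) M]

/-- The family `E` vanishes outside of `A`, and on `A` it is a homogeneous `K`-basis of the graded
module `M` on which monomials act by translation of the index. Monomial ideals and the quotients by
them are of this form. -/
structure IsMonomialBasis (ℳ : (Fin n → ℤ) → Submodule K M) (A : Set (Fin n →₀ ℕ))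
    (E : (Fin n →₀ ℕ) → M) : Prop where
  linearIndepOn : LinearIndepOn K E A
  span_eq_top : Submodule.span K (E '' A) = ⊤
  eq_zero : ∀ a, a ∉ A → E a = 0
  monomial_smul : ∀ a ∈ A, ∀ b, MvPolynomial.monomial b (1 : K) • E a = E (b + a)
  homogeneous : ∀ a ∈ A, ∃ α, E a ∈ ℳ α
  exists_of_homogeneous : ∀ α, ∀ x ∈ ℳ α, x ≠ 0 → ∃ a ∈ A, ∃ c : K, c ≠ 0 ∧ x = c • E a

theorem mem_stanleyCell_iff {a b : Fin n →₀ ℕ} {Z : Finset (Fin n)} :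
    b ∈ stanleyCell a Z ↔ ∃ v : Fin n →₀ ℕ, v.support ⊆ Z ∧ b = v + a := by
  constructor
  · rintro ⟨h1, h2⟩
    refine ⟨b - a, fun j hj => ?_, (tsub_add_cancel_of_le h1).symm⟩
    by_contra hjZ
    rw [Finsupp.mem_support_iff, Finsupp.tsub_apply, h2 j hjZ] at hj
    omega
  · rintro ⟨v, hv, rfl⟩
    refine ⟨le_add_self, fun j hj => ?_⟩
    have : v j = 0 := Finsupp.notMem_support_iff.1 fun h => hj (hv h)
    simp [this]

theorem self_mem_stanleyCell (a : Fin n →₀ ℕ) (Z : Finset (Fin n)) : a ∈ stanleyCell a Z :=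
  ⟨le_rfl, fun _ _ => rfl⟩

theorem MvPolynomial.mem_supported_iff_support {f : MvPolynomial (Fin n) K} {Z : Finset (Fin n)} :
    f ∈ MvPolynomial.supported K (Z : Set (Fin n)) ↔ ∀ v ∈ f.support, v.support ⊆ Z := by
  rw [MvPolynomial.mem_supported, Finset.coe_subset]
  constructor
  · intro h v hv j hj
    exact h ((MvPolynomial.mem_vars_iff_mem_support j).2 ⟨v, hv, hj⟩)
  · intro h j hj
    obtain ⟨v, hv, hjv⟩ := (MvPolynomial.mem_vars_iff_mem_support j).1 hj
    exact h v hv hjv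

theorem MvPolynomial.monomial_mem_supported {v : Fin n →₀ ℕ} {Z : Finset (Fin n)}
    (hv : v.support ⊆ Z) (c : K) :
    MvPolynomial.monomial v c ∈ MvPolynomial.supported K (Z : Set (Fin n)) := by
  rw [MvPolynomial.mem_supported_iff_support]
  intro w hw
  rwa [Finset.mem_singleton.1 (MvPolynomial.support_monomial_subset hw)]

namespace IsMonomialBasis

variable {ℳ : (Fin n → ℤ) → Submodule K M} {A : Set (Fin n →₀ ℕ)} {E : (Fin n →₀ ℕ) → M}

theorem smul_eq_sum (h : IsMonomialBasis ℳ A E) {a : Fin n →₀ ℕ} (ha : a ∈ A)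
    (f : MvPolynomial (Fin n) K) :
    f • E a = ∑ v ∈ f.support, f.coeff v • E (v + a) := by
  conv_lhs => rw [f.as_sum, Finset.sum_smul]
  refine Finset.sum_congr rfl fun v _ => ?_
  rw [← h.monomial_smul a ha, ← smul_assoc, MvPolynomial.smul_monomial, smul_eq_mul, mul_one]

theorem stanleySpace_eq (h : IsMonomialBasis ℳ A E) {a : Fin n →₀ ℕ} (ha : a ∈ A) {c : K}
    (hc : c ≠ 0) (Z : Finset (Fin n)) :
    stanleySpace (K := K) Z (c • E a) = Submodule.span K (E '' stanleyCell a Z) := by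
  have hcomm : ∀ f : MvPolynomial (Fin n) K, f • c • E a = c • f • E a := by
    intro f
    rw [← smul_one_smul (MvPolynomial (Fin n) K) c (E a), smul_comm, smul_one_smul]
  apply le_antisymm
  · rintro _ ⟨f, hf, rfl⟩
    have hf' : f ∈ MvPolynomial.supported K (Z : Set (Fin n)) := hf
    rw [MvPolynomial.mem_supported_iff_support] at hf'
    change f • c • E a ∈ _
    rw [hcomm, h.smul_eq_sum ha]
    refine Submodule.smul_mem _ _ (Submodule.sum_mem _ fun v hv => Submodule.smul_mem _ _ ?_)
    exact Submodule.subset_span ⟨v + a, mem_stanleyCell_iff.2 ⟨v, hf' v hv, rfl⟩, rfl⟩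
  · rw [Submodule.span_le]
    rintro _ ⟨b, hb, rfl⟩
    obtain ⟨v, hv, rfl⟩ := mem_stanleyCell_iff.1 hb
    refine ⟨MvPolynomial.monomial v c⁻¹, MvPolynomial.monomial_mem_supported hv _, ?_⟩
    change MvPolynomial.monomial v c⁻¹ • c • E a = E (v + a)
    rw [hcomm, ← h.monomial_smul a ha, ← smul_assoc, MvPolynomial.smul_monomial, smul_eq_mul,
      mul_inv_cancel₀ hc]

theorem smul_injective (h : IsMonomialBasis ℳ A E) {a : Fin n →₀ ℕ} {Z : Finset (Fin n)}
    (hcell : stanleyCell a Z ⊆ A) :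
    Function.Injective (fun f : MvPolynomial.supported K (Z : Set (Fin n)) =>
      (f : MvPolynomial (Fin n) K) • E a) := by
  have ha : a ∈ A := hcell (self_mem_stanleyCell a Z)
  suffices ∀ f ∈ MvPolynomial.supported K (Z : Set (Fin n)), f • E a = 0 → f = 0 by
    intro f g hfg
    have := this (f - g : MvPolynomial (Fin n) K) (Subalgebra.sub_mem _ f.2 g.2)
      (by rw [sub_smul]; exact sub_eq_zero.2 hfg)
    exact Subtype.ext (sub_eq_zero.1 this)
  intro f hf h0
  rw [MvPolynomial.mem_supported_iff_support] at hf
  rw [h.smul_eq_sum ha] at h0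
  have hli : LinearIndepOn K (E ∘ fun v => v + a) (f.support : Set (Fin n →₀ ℕ)) := by
    refine (h.linearIndepOn.mono ?_).comp_of_image (add_left_injective a).injOn
    rintro _ ⟨v, hv, rfl⟩
    exact hcell (mem_stanleyCell_iff.2 ⟨v, hf v hv, rfl⟩)
  have := linearIndepOn_finset_iff.1 hli (fun v => f.coeff v) h0
  rw [← MvPolynomial.support_eq_empty, Finset.eq_empty_iff_forall_notMem]
  intro v hv
  exact MvPolynomial.mem_support_iff.1 hv (this v hv)

/-- Freeness of `x K[Z]` means that no monomial of the cell is killed. -/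
theorem stanleyCell_subset (h : IsMonomialBasis ℳ A E) {a : Fin n →₀ ℕ} (ha : a ∈ A) {c : K}
    {Z : Finset (Fin n)}
    (hinj : Function.Injective (fun f : MvPolynomial.supported K (Z : Set (Fin n)) =>
      (f : MvPolynomial (Fin n) K) • c • E a)) : stanleyCell a Z ⊆ A := by
  intro b hb
  obtain ⟨v, hv, rfl⟩ := mem_stanleyCell_iff.1 hb
  by_contra hA
  have := @hinj ⟨_, MvPolynomial.monomial_mem_supported hv 1⟩ 0 (by
    change MvPolynomial.monomial v (1 : K) • c • E a = (0 : MvPolynomial (Fin n) K) • c • E a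
    rw [← smul_one_smul (MvPolynomial (Fin n) K) c (E a), smul_comm, h.monomial_smul a ha,
      h.eq_zero _ hA, smul_zero, zero_smul])
  have h0 := congrArg Subtype.val this
  change MvPolynomial.monomial v (1 : K) = 0 at h0
  exact one_ne_zero (MvPolynomial.monomial_eq_zero.1 h0)

/-- A partition of the index set into cells of codimension at most `c` is the same as a Stanley
decomposition of depth at least `n - c`. -/
theorem exists_stanleyDecomposition_iff (h : IsMonomialBasis ℳ A E) (c : ℕ) :
    (∃ D : StanleyDecomposition ℳ, ((n - c : ℕ) : ℕ∞) ≤ D.depth) ↔ HasStanleyPartition c A := by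
  constructor
  · rintro ⟨D, hD⟩
    have hne : ∀ i, D.x i ≠ 0 := by
      intro i h0
      have := @D.free i 1 0 (by simp [h0])
      exact one_ne_zero this
    have hex : ∀ i, ∃ a ∈ A, ∃ c : K, c ≠ 0 ∧ D.x i = c • E a := fun i => by
      obtain ⟨α, hα⟩ := D.homogeneous i
      exact h.exists_of_homogeneous α _ hα (hne i)
    choose a ha γ hγ hx using hex
    have hspace : ∀ i, stanleySpace (K := K) (D.Z i) (D.x i)
        = Submodule.span K (E '' stanleyCell (a i) (D.Z i)) := fun i => by
      rw [hx, h.stanleySpace_eq (ha i) (hγ i)]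
    have hcell : ∀ i, stanleyCell (a i) (D.Z i) ⊆ A := fun i => by
      refine h.stanleyCell_subset (ha i) (c := γ i) ?_
      rw [← hx]
      exact D.free i
    have hint := (DirectSum.isInternal_submodule_iff_iSupIndep_and_iSup_eq_top _).1 D.isInternal
    simp_rw [hspace, ← Submodule.span_iUnion, ← Set.image_iUnion] at hint
    refine ⟨Fin D.r, inferInstance, a, D.Z, fun i => ?_, fun i j hij => ?_, ?_⟩
    · have := hD.trans (iInf_le _ i)
      rw [Nat.cast_le] at this
      omega
    · refine Set.disjoint_left.2 fun b hbi hbj => ?_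
      refine h.linearIndepOn.ne_zero (hcell i hbi) ?_
      exact Submodule.disjoint_def.1 (hint.1.pairwiseDisjoint hij) (E b)
        (Submodule.subset_span ⟨b, hbi, rfl⟩) (Submodule.subset_span ⟨b, hbj, rfl⟩)
    · refine (Set.iUnion_subset hcell).antisymm fun b hb => ?_
      by_contra hbn
      refine h.linearIndepOn.notMem_span hb ?_
      have : E b ∈ Submodule.span K (E '' ⋃ i, stanleyCell (a i) (D.Z i)) := by
        rw [hint.2]
        trivial
      refine Submodule.span_mono (Set.image_mono fun v hv => ?_) this
      exact ⟨Set.iUnion_subset hcell hv, fun he => hbn (he ▸ hv)⟩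
  · rintro ⟨ι, hι, a, Z, hZ, hd, hu⟩
    obtain ⟨r, ⟨e⟩⟩ := Finite.exists_equiv_fin ι
    have hcell : ∀ i, stanleyCell (a i) (Z i) ⊆ A := fun i => by
      rw [← hu]
      exact Set.subset_iUnion (fun i => stanleyCell (a i) (Z i)) i
    have ha : ∀ i, a i ∈ A := fun i => hcell i (self_mem_stanleyCell _ _)
    have hspace : ∀ i, stanleySpace (K := K) (Z i) (E (a i))
        = Submodule.span K (E '' stanleyCell (a i) (Z i)) := fun i => by
      conv_lhs => rw [← one_smul K (E (a i))]
      exact h.stanleySpace_eq (ha i) one_ne_zero _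
    refine ⟨⟨r, fun i => Z (e.symm i), fun i => E (a (e.symm i)), fun i => h.homogeneous _ (ha _),
      fun i => h.smul_injective (hcell _), ?_⟩, ?_⟩
    · rw [DirectSum.isInternal_submodule_iff_iSupIndep_and_iSup_eq_top]
      simp_rw [hspace]
      refine ⟨(h.linearIndepOn.iSupIndep_span hcell hd).comp e.symm.injective, ?_⟩
      rw [e.symm.iSup_comp (g := fun i => Submodule.span K (E '' stanleyCell (a i) (Z i))),
        ← Submodule.span_iUnion, ← Set.image_iUnion, hu, h.span_eq_top]
    · refine le_iInf fun i => ?_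
      have := hZ (e.symm i)
      exact Nat.cast_le.2 (by change n - c ≤ (Z (e.symm i)).card; omega)

theorem stanleyProjDim_le_iff (h : IsMonomialBasis ℳ A E) (hA : ∃ c, HasStanleyPartition c A)
    (c : ℕ) : stanleyProjDim ℳ ≤ c ↔ HasStanleyPartition c A := by
  rw [stanleyProjDim, tsub_le_iff_right]
  constructor
  · intro hle
    -- For `n ≤ c` the left-hand side holds trivially, and any partition serves on the right. This is
    -- where the existence of a partition is needed, as the supremum over no decompositions is `0`.
    rcases le_or_gt n c with hnc | hnc
    · obtain ⟨c', ι, hι, a, Z, -, hd⟩ := hA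
      exact ⟨ι, hι, a, Z, fun i => by omega, hd⟩
    · rw [← h.exists_stanleyDecomposition_iff]
      by_contra! hcon
      have hsup : stanleyDepth ℳ ≤ ((n - c - 1 : ℕ) : ℕ∞) := by
        refine iSup_le fun D => ?_
        have := hcon D
        rw [show n - c = (n - c - 1) + 1 by omega, Nat.cast_add, Nat.cast_one] at this
        exact Order.lt_add_one_iff_of_not_isMax (by simp) |>.1 this
      have := hle.trans (add_le_add_right hsup _)
      rw [← Nat.cast_add, Nat.cast_le] at this
      omega
  · intro hc
    obtain ⟨D, hD⟩ := (h.exists_stanleyDecomposition_iff c).2 hc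
    have := hD.trans (le_iSup _ D)
    calc (n : ℕ∞) ≤ (c : ℕ∞) + ((n - c : ℕ) : ℕ∞) := by
          rw [← Nat.cast_add, Nat.cast_le]
          omega
      _ ≤ _ := by gcongr; exact this

end IsMonomialBasis

end MonomialBasis

/-! ### Monomial ideals and their quotients have monomial bases -/

namespace MonomialIdeal

variable {K : Type*} [Field K] {n : ℕ}

/-- The exponent vectors of the monomials in `I`. -/
def exponents (I : Ideal (MvPolynomial (Fin n) K)) : Set (Fin n →₀ ℕ) :=
  {a | MvPolynomial.monomial a (1 : K) ∈ I}

theorem IsMonomial.mem_iff {I : Ideal (MvPolynomial (Fin n) K)} (hI : IsMonomial I)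
    {f : MvPolynomial (Fin n) K} : f ∈ I ↔ ∀ a ∈ f.support, a ∈ exponents I := by
  obtain ⟨s, rfl⟩ := hI
  simp only [exponents, Set.mem_ofPred_eq]
  rw [MvPolynomial.mem_ideal_span_monomial_image]
  refine forall₂_congr fun a _ => ?_
  rw [MvPolynomial.mem_ideal_span_monomial_image]
  simp

theorem isUpperSet_exponents (I : Ideal (MvPolynomial (Fin n) K)) : IsUpperSet (exponents I) := by
  intro a b hab ha
  have := I.mul_mem_left (MvPolynomial.monomial (b - a) (1 : K)) ha
  rwa [MvPolynomial.monomial_mul, tsub_add_cancel_of_le hab, one_mul] at this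

/-- Multidegrees with a negative entry have the zero component; there the coefficient is `0`. -/
theorem polyComponent_cases {α : Fin n → ℤ} {f : MvPolynomial (Fin n) K}
    (hf : f ∈ polyComponent K α) : ∃ a c, f = MvPolynomial.monomial a c := by
  by_cases h : ∃ m : Fin n →₀ ℕ, ∀ i, (m i : ℤ) = α i
  · obtain ⟨m, hm⟩ := h
    have hset : {f : MvPolynomial (Fin n) K | ∃ m : Fin n →₀ ℕ, (∀ i, (m i : ℤ) = α i) ∧
        f = MvPolynomial.monomial m 1} = {MvPolynomial.monomial m 1} := by
      ext f
      constructor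
      · rintro ⟨m', hm', rfl⟩
        have : m' = m := Finsupp.ext fun i => by exact_mod_cast (hm' i).trans (hm i).symm
        rw [this]
        rfl
      · rintro rfl
        exact ⟨m, hm, rfl⟩
    rw [polyComponent, hset, Submodule.mem_span_singleton] at hf
    obtain ⟨c, rfl⟩ := hf
    exact ⟨m, c, by rw [MvPolynomial.smul_monomial, smul_eq_mul, mul_one]⟩
  · have hset : {f : MvPolynomial (Fin n) K | ∃ m : Fin n →₀ ℕ, (∀ i, (m i : ℤ) = α i) ∧
        f = MvPolynomial.monomial m 1} = ∅ :=
      Set.eq_empty_of_forall_notMem fun f ⟨m, hm, _⟩ => h ⟨m, hm⟩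
    rw [polyComponent, hset, Submodule.span_empty, Submodule.mem_bot] at hf
    exact ⟨0, 0, by simp [hf]⟩

theorem monomial_mem_polyComponent (a : Fin n →₀ ℕ) :
    MvPolynomial.monomial a (1 : K) ∈ polyComponent K (fun i => (a i : ℤ)) :=
  Submodule.subset_span ⟨a, fun _ => rfl, rfl⟩

open Classical in
/-- The basis of an ideal consists of its monomials; outside of the exponent set the family takes the
value `0`. -/
theorem IsMonomial.isMonomialBasis_ideal {I : Ideal (MvPolynomial (Fin n) K)} (hI : IsMonomial I) :
    IsMonomialBasis (idealGrading I) (exponents I)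
      (fun a => if h : a ∈ exponents I then (⟨MvPolynomial.monomial a 1, h⟩ : I) else 0) where
  linearIndepOn := by
    rw [linearIndepOn_iff']
    intro t c ht h0 b hb
    have h1 := congrArg (fun f : I => MvPolynomial.coeff b (f : MvPolynomial (Fin n) K)) h0
    simp only [Submodule.coe_sum, MvPolynomial.coeff_sum] at h1
    rw [Finset.sum_eq_single b] at h1
    · have : b ∈ exponents I := ht hb
      simpa [this] using h1
    · intro a ha hab
      have : a ∈ exponents I := ht ha
      simp [this, MvPolynomial.coeff_monomial, hab]
    · exact fun h => (h hb).elim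
  span_eq_top := by
    rw [eq_top_iff]
    rintro f -
    have hsum : f = ∑ a ∈ (f : MvPolynomial (Fin n) K).support,
        (f : MvPolynomial (Fin n) K).coeff a •
          (if h : a ∈ exponents I then (⟨MvPolynomial.monomial a 1, h⟩ : I) else 0) := by
      apply Subtype.ext
      rw [Submodule.coe_sum]
      conv_lhs => rw [(f : MvPolynomial (Fin n) K).as_sum]
      refine Finset.sum_congr rfl fun a ha => ?_
      rw [dif_pos (hI.mem_iff.1 f.2 a ha)]
      simp [MvPolynomial.smul_monomial]
    rw [hsum]
    exact Submodule.sum_mem _ fun a ha => Submodule.smul_mem _ _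
      (Submodule.subset_span ⟨a, hI.mem_iff.1 f.2 a ha, rfl⟩)
  eq_zero a ha := dif_neg ha
  monomial_smul a ha b := by
    rw [dif_pos ha, dif_pos (isUpperSet_exponents I le_add_self ha)]
    apply Subtype.ext
    simp [MvPolynomial.monomial_mul]
  homogeneous a ha := by
    refine ⟨fun i => (a i : ℤ), ?_⟩
    rw [dif_pos ha]
    exact monomial_mem_polyComponent a
  exists_of_homogeneous α x hx h0 := by
    obtain ⟨a, c, hac⟩ := polyComponent_cases (f := (x : MvPolynomial (Fin n) K)) hx
    have hc : c ≠ 0 := by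
      rintro rfl
      exact h0 (Subtype.ext (by simpa using hac))
    have ha : a ∈ exponents I := hI.mem_iff.1 x.2 a (by simp [hac, hc])
    refine ⟨a, ha, c, hc, Subtype.ext ?_⟩
    rw [dif_pos ha, hac]
    simp [MvPolynomial.smul_monomial]

theorem quotient_mk_monomial (I : Ideal (MvPolynomial (Fin n) K)) (a : Fin n →₀ ℕ) (c : K) :
    Ideal.Quotient.mk I (MvPolynomial.monomial a c)
      = c • Ideal.Quotient.mk I (MvPolynomial.monomial a 1) := by
  conv_lhs => rw [← mul_one c, ← smul_eq_mul, ← MvPolynomial.smul_monomial]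
  exact map_smul (Ideal.Quotient.mkₐ K I) _ _

theorem IsMonomial.isMonomialBasis_quotient {I : Ideal (MvPolynomial (Fin n) K)}
    (hI : IsMonomial I) :
    IsMonomialBasis (quotientGrading I) (exponents I)ᶜ
      (fun a => Ideal.Quotient.mk I (MvPolynomial.monomial a 1)) where
  linearIndepOn := by
    rw [linearIndepOn_iff']
    intro t c ht h0 b hb
    have hmem : ∑ a ∈ t, MvPolynomial.monomial a (c a) ∈ I := by
      rw [← Ideal.Quotient.eq_zero_iff_mem, map_sum, ← h0]
      exact Finset.sum_congr rfl fun a _ => quotient_mk_monomial I a (c a)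
    have hcoeff : MvPolynomial.coeff b (∑ a ∈ t, MvPolynomial.monomial a (c a)) = c b := by
      rw [MvPolynomial.coeff_sum, Finset.sum_eq_single b]
      · simp
      · intro a _ hab
        simp [MvPolynomial.coeff_monomial, hab]
      · exact fun h => (h hb).elim
    by_contra hc
    exact ht hb (hI.mem_iff.1 hmem b (by rwa [MvPolynomial.mem_support_iff, hcoeff]))
  span_eq_top := by
    rw [eq_top_iff]
    rintro f -
    obtain ⟨f, rfl⟩ := Ideal.Quotient.mk_surjective f
    rw [f.as_sum, map_sum]
    refine Submodule.sum_mem _ fun a _ => ?_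
    rw [quotient_mk_monomial]
    refine Submodule.smul_mem _ _ ?_
    by_cases ha : a ∈ exponents I
    · rw [Ideal.Quotient.eq_zero_iff_mem.2 ha]
      exact Submodule.zero_mem _
    · exact Submodule.subset_span ⟨a, ha, rfl⟩
  eq_zero a ha := Ideal.Quotient.eq_zero_iff_mem.2 (not_not.1 ha)
  monomial_smul a _ b := by
    change Ideal.Quotient.mk I (MvPolynomial.monomial b 1 * MvPolynomial.monomial a 1) = _
    rw [MvPolynomial.monomial_mul, one_mul]
  homogeneous a _ := ⟨fun i => (a i : ℤ), _, monomial_mem_polyComponent a, rfl⟩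
  exists_of_homogeneous α x hx h0 := by
    obtain ⟨f, hf, rfl⟩ := hx
    obtain ⟨a, c, rfl⟩ := polyComponent_cases hf
    refine ⟨a, fun ha => h0 ?_, c, ?_, quotient_mk_monomial I a c⟩
    · refine (quotient_mk_monomial I a c).trans ?_
      rw [ Ideal.Quotient.eq_zero_iff_mem.2 ha, smul_zero]
    · rintro rfl
      exact h0 (by simp)

theorem exponents_span (s : Set (Fin n →₀ ℕ)) :
    exponents (Ideal.span ((fun a => MvPolynomial.monomial a (1 : K)) '' s)) =
      ⋃ u ∈ s, Set.Ici u := by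
  ext a
  simp only [exponents, Set.mem_ofPred_eq]
  rw [MvPolynomial.mem_ideal_span_monomial_image]
  simp

end MonomialIdeal

/-! ### Graded submodules of free modules as monotone families of vector spaces -/

section GradedFamily

universe u

variable {K : Type u} [Field K] {m n : ℕ} {G Γ : Type u}

/-- The vector of the coefficients of `X^a`. -/
noncomputable def vecCoeff (a : Fin n →₀ ℕ) :
    (G →₀ MvPolynomial (Fin n) K) →ₗ[K] (G →₀ K) :=
  Finsupp.mapRange.linearMap (MvPolynomial.lcoeff K a)

@[simp]
theorem vecCoeff_apply (a : Fin n →₀ ℕ) (f : G →₀ MvPolynomial (Fin n) K) (g : G) :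
    vecCoeff a f g = (f g).coeff a := rfl

theorem vecCoeff_ext {f f' : G →₀ MvPolynomial (Fin n) K}
    (h : ∀ a, vecCoeff a f = vecCoeff a f') : f = f' := by
  ext g a
  exact DFunLike.congr_fun (h a) g

theorem vecCoeff_smul (a : Fin n →₀ ℕ) (p : MvPolynomial (Fin n) K)
    (f : G →₀ MvPolynomial (Fin n) K) :
    vecCoeff a (p • f) = ∑ x ∈ Finset.HasAntidiagonal.antidiagonal a, p.coeff x.1 • vecCoeff x.2 f := by
  ext g
  simp [MvPolynomial.coeff_mul, Finsupp.finsetSum_apply]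

/-- The vector `X^a v`. -/
noncomputable def vecMonomial (a : Fin n →₀ ℕ) :
    (G →₀ K) →ₗ[K] (G →₀ MvPolynomial (Fin n) K) :=
  Finsupp.mapRange.linearMap (MvPolynomial.monomial a)

@[simp]
theorem vecMonomial_apply (a : Fin n →₀ ℕ) (v : G →₀ K) (g : G) :
    vecMonomial a v g = MvPolynomial.monomial a (v g) := rfl

theorem vecCoeff_vecMonomial_self (a : Fin n →₀ ℕ) (v : G →₀ K) :
    vecCoeff a (vecMonomial a v) = v := by
  ext g
  simp

theorem vecCoeff_vecMonomial_of_ne {a b : Fin n →₀ ℕ} (h : a ≠ b) (v : G →₀ K) :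
    vecCoeff b (vecMonomial a v) = 0 := by
  ext g
  simp [MvPolynomial.coeff_monomial, h]

theorem monomial_smul_vecMonomial (a b : Fin n →₀ ℕ) (v : G →₀ K) :
    MvPolynomial.monomial b (1 : K) • vecMonomial a v = vecMonomial (b + a) v := by
  ext1 g
  simp [MvPolynomial.monomial_mul]

theorem vecCoeff_monomial_smul (a b : Fin n →₀ ℕ) (f : G →₀ MvPolynomial (Fin n) K) :
    vecCoeff (b + a) (MvPolynomial.monomial b (1 : K) • f) = vecCoeff a f := by
  ext g
  simp [MvPolynomial.coeff_monomial_mul]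

theorem exists_eq_sum_vecMonomial (f : G →₀ MvPolynomial (Fin n) K) :
    ∃ s : Finset (Fin n →₀ ℕ), f = ∑ a ∈ s, vecMonomial a (vecCoeff a f) := by
  classical
  refine ⟨f.support.biUnion fun g => (f g).support, ?_⟩
  ext1 g
  rw [Finsupp.finsetSum_apply]
  simp only [vecMonomial_apply, vecCoeff_apply]
  rw [← Finset.sum_subset (s₁ := (f g).support), ← MvPolynomial.as_sum]
  · intro a ha
    refine Finset.mem_biUnion.2 ⟨g, ?_, ha⟩
    rw [Finsupp.mem_support_iff]
    intro h0
    simp [h0] at ha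
  · intro a _ ha
    rw [MvPolynomial.notMem_support_iff.1 ha, map_zero]

/-- The graded submodule of the free module on `G` whose component of degree `a` is `X^a N a`. -/
def familyModule (N : (Fin n →₀ ℕ) →o Submodule K (G →₀ K)) :
    Submodule (MvPolynomial (Fin n) K) (G →₀ MvPolynomial (Fin n) K) where
  carrier := {f | ∀ a, vecCoeff a f ∈ N a}
  add_mem' hf hg a := by
    rw [map_add]
    exact (N a).add_mem (hf a) (hg a)
  zero_mem' a := by
    rw [map_zero]
    exact (N a).zero_mem
  smul_mem' p f hf a := by
    rw [vecCoeff_smul]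
    refine Submodule.sum_mem _ fun x hx => Submodule.smul_mem _ _ (N.monotone ?_ (hf x.2))
    exact (Finset.HasAntidiagonal.mem_antidiagonal.1 hx) ▸ le_add_self

theorem mem_familyModule {N : (Fin n →₀ ℕ) →o Submodule K (G →₀ K)}
    {f : G →₀ MvPolynomial (Fin n) K} : f ∈ familyModule N ↔ ∀ a, vecCoeff a f ∈ N a :=
  Iff.rfl

theorem vecMonomial_mem_familyModule {N : (Fin n →₀ ℕ) →o Submodule K (G →₀ K)}
    {a : Fin n →₀ ℕ} {v : G →₀ K} (hv : v ∈ N a) : vecMonomial a v ∈ familyModule N := by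
  intro b
  by_cases h : a = b
  · subst h
    rwa [vecCoeff_vecMonomial_self]
  · rw [vecCoeff_vecMonomial_of_ne h]
    exact Submodule.zero_mem _

/-- The homomorphism of free modules with the same (scalar) matrix as `h`. -/
noncomputable def vecBaseChange (h : (Γ →₀ K) →ₗ[K] (G →₀ K)) :
    (Γ →₀ MvPolynomial (Fin n) K) →ₗ[MvPolynomial (Fin n) K] (G →₀ MvPolynomial (Fin n) K) :=
  Finsupp.linearCombination _ fun γ => vecMonomial 0 (h (Finsupp.single γ 1))

theorem vecCoeff_vecBaseChange (h : (Γ →₀ K) →ₗ[K] (G →₀ K)) (a : Fin n →₀ ℕ)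
    (f : Γ →₀ MvPolynomial (Fin n) K) : vecCoeff a (vecBaseChange h f) = h (vecCoeff a f) := by
  induction f using Finsupp.induction_linear with
  | zero => simp
  | add f g hf hg => simp only [map_add, hf, hg]
  | single γ p =>
    have h1 : vecCoeff a (Finsupp.single γ p) = p.coeff a • Finsupp.single γ (1 : K) := by
      ext γ'
      by_cases hγ : γ = γ'
      · subst hγ
        simp
      · simp [hγ]
    rw [h1, map_smul, vecBaseChange, Finsupp.linearCombination_single]
    ext g
    simp only [Finsupp.smul_apply, smul_eq_mul, vecCoeff_apply, vecMonomial_apply,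
      MvPolynomial.monomial_zero']
    rw [mul_comm, MvPolynomial.coeff_C_mul, mul_comm]

theorem vecBaseChange_mem {h : (Γ →₀ K) →ₗ[K] (G →₀ K)}
    {F : (Fin n →₀ ℕ) →o Submodule K (Γ →₀ K)} {N : (Fin n →₀ ℕ) →o Submodule K (G →₀ K)}
    (hFN : ∀ a, ∀ v ∈ F a, h v ∈ N a) :
    ∀ f ∈ familyModule F, vecBaseChange h f ∈ familyModule N := fun f hf a => by
  rw [vecCoeff_vecBaseChange]
  exact hFN a _ (hf a)

theorem vecBaseChange_restrict_surjective {h : (Γ →₀ K) →ₗ[K] (G →₀ K)}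
    {F : (Fin n →₀ ℕ) →o Submodule K (Γ →₀ K)} {N : (Fin n →₀ ℕ) →o Submodule K (G →₀ K)}
    (hFN : ∀ a, ∀ v ∈ F a, h v ∈ N a) (hsurj : ∀ a, ∀ w ∈ N a, ∃ v ∈ F a, h v = w) :
    Function.Surjective ((vecBaseChange h).restrict (vecBaseChange_mem hFN)) := by
  rintro ⟨f, hf⟩
  choose c hc hcf using fun a => hsurj a (vecCoeff a f) (hf a)
  obtain ⟨s, hs⟩ := exists_eq_sum_vecMonomial f
  refine ⟨⟨∑ a ∈ s, vecMonomial a (c a),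
    Submodule.sum_mem _ fun a _ => vecMonomial_mem_familyModule (hc a)⟩, Subtype.ext ?_⟩
  change vecBaseChange h (∑ a ∈ s, vecMonomial a (c a)) = f
  conv_rhs => rw [hs]
  rw [map_sum]
  refine Finset.sum_congr rfl fun a _ => vecCoeff_ext fun b => ?_
  rw [vecCoeff_vecBaseChange]
  by_cases hab : a = b
  · subst hab
    rw [vecCoeff_vecMonomial_self, vecCoeff_vecMonomial_self, hcf]
  · rw [vecCoeff_vecMonomial_of_ne hab, vecCoeff_vecMonomial_of_ne hab, map_zero]

/-! ### Pullback of graded modules along partially residuated maps -/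

/-- The family of a graded free module with basis elements of the degrees `d γ`. -/
noncomputable def freeFamily (K : Type u) [Field K] (d : Γ → Fin n →₀ ℕ) :
    (Fin n →₀ ℕ) →o Submodule K (Γ →₀ K) where
  toFun a := Finsupp.supported K K {γ | d γ ≤ a}
  monotone' _ _ hab := Finsupp.supported_mono fun _ hγ => le_trans hγ hab

/-- The pullback of a graded free module along a partially residuated map is free: a basis element
of degree `a` is moved to the generator of the preimage of `Ici a`, or vanishes if the preimage is
empty. -/
theorem projective_familyModule_freeFamily_comp (Θ : (Fin m →₀ ℕ) →o (Fin n →₀ ℕ))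
    (hΘ : IsPartiallyResiduated Θ) (d : Γ → Fin n →₀ ℕ) :
    Module.Projective (MvPolynomial (Fin m) K) (familyModule ((freeFamily K d).comp Θ)) := by
  classical
  -- The basis elements that survive the pullback.
  let Γ₀ := {γ : Γ // ∃ b, Θ ⁻¹' Set.Ici (d γ) = Set.Ici b}
  choose β hβ using fun γ : Γ₀ => γ.2
  let v : Γ₀ → (Γ →₀ MvPolynomial (Fin m) K) := fun γ =>
    Finsupp.single γ.1 (MvPolynomial.monomial (β γ) 1)
  have hli : LinearIndependent (MvPolynomial (Fin m) K) v := by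
    rw [linearIndependent_iff']
    intro s c h0 γ hγ
    have h1 := DFunLike.congr_fun h0 γ.1
    rw [Finsupp.finsetSum_apply, Finset.sum_eq_single γ] at h1
    · simpa [v] using h1
    · intro γ' _ hne
      have : γ'.1 ≠ γ.1 := fun h => hne (Subtype.ext h)
      simp [v, this]
    · exact fun h => (h hγ).elim
  have hspan : Submodule.span (MvPolynomial (Fin m) K) (Set.range v)
      = familyModule ((freeFamily K d).comp Θ) := by
    apply le_antisymm
    · rw [Submodule.span_le]
      rintro _ ⟨γ, rfl⟩ a
      change _ ∈ Finsupp.supported K K {γ | d γ ≤ Θ a}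
      rw [Finsupp.mem_supported']
      intro γ' hγ'
      by_cases hne : γ.1 = γ'
      · subst hne
        have : β γ ≠ a := by
          rintro rfl
          have : β γ ∈ Θ ⁻¹' Set.Ici (d γ.1) := (hβ γ).symm ▸ Set.self_mem_Ici
          exact hγ' this
        simp [v, MvPolynomial.coeff_monomial, this]
      · simp [v, hne]
    · intro f hf
      rw [← Finsupp.sum_single f]
      refine Submodule.sum_mem _ fun γ hγ => ?_
      have hcoeff : ∀ b ∈ (f γ).support, b ∈ Θ ⁻¹' Set.Ici (d γ) := by
        intro b hb
        by_contra hcon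
        have := (Finsupp.mem_supported' K _).1 (hf b) γ hcon
        exact MvPolynomial.mem_support_iff.1 hb this
      have hne : (f γ).support.Nonempty := by
        rw [Finset.nonempty_iff_ne_empty, Ne, MvPolynomial.support_eq_empty]
        exact Finsupp.mem_support_iff.1 hγ
      have hγ₀ : ∃ b, Θ ⁻¹' Set.Ici (d γ) = Set.Ici b := by
        refine (hΘ (d γ)).resolve_left fun h0 => ?_
        obtain ⟨b, hb⟩ := hne
        have := hcoeff b hb
        rw [h0] at this
        exact this
      have hmem : f γ ∈ Ideal.span ((fun a => MvPolynomial.monomial a (1 : K)) ''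
          {β ⟨γ, hγ₀⟩}) := by
        rw [MvPolynomial.mem_ideal_span_monomial_image]
        intro b hb
        have := hcoeff b hb
        rw [hβ ⟨γ, hγ₀⟩] at this
        exact ⟨_, rfl, this⟩
      rw [Set.image_singleton, Ideal.mem_span_singleton'] at hmem
      obtain ⟨c, hc⟩ := hmem
      have : Finsupp.single γ (f γ) = c • v ⟨γ, hγ₀⟩ := by
        rw [← hc, Finsupp.smul_single, smul_eq_mul]
      rw [this]
      exact Submodule.smul_mem _ _ (Submodule.subset_span ⟨_, rfl⟩)
  rw [← hspan]
  exact Module.Projective.of_basis (Module.Basis.span hli)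

/-- The degrees of the standard free cover of a family, which has a basis element for every
homogeneous element. -/
def coverDegree (N : (Fin n →₀ ℕ) →o Submodule K (G →₀ K)) :
    (Σ a : Fin n →₀ ℕ, N a) → (Fin n →₀ ℕ) := Sigma.fst

/-- The standard free cover of a family. -/
noncomputable def coverMap (N : (Fin n →₀ ℕ) →o Submodule K (G →₀ K)) :
    ((Σ a : Fin n →₀ ℕ, N a) →₀ K) →ₗ[K] (G →₀ K) :=
  Finsupp.linearCombination K fun γ => (γ.2 : G →₀ K)

theorem map_coverMap (N : (Fin n →₀ ℕ) →o Submodule K (G →₀ K)) (a : Fin n →₀ ℕ) :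
    (freeFamily K (coverDegree N) a).map (coverMap N) = N a := by
  change (Finsupp.supported K K _).map (Finsupp.linearCombination K _) = _
  rw [← Finsupp.span_image_eq_map_linearCombination]
  apply le_antisymm
  · rw [Submodule.span_le]
    rintro _ ⟨γ, hγ, rfl⟩
    exact N.monotone hγ γ.2.2
  · intro v hv
    exact Submodule.subset_span ⟨⟨a, v, hv⟩, le_refl a, rfl⟩

theorem coverMap_mem (N : (Fin n →₀ ℕ) →o Submodule K (G →₀ K)) (a : Fin n →₀ ℕ) :
    ∀ v ∈ freeFamily K (coverDegree N) a, coverMap N v ∈ N a := fun v hv => by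
  rw [← map_coverMap N a]
  exact Submodule.mem_map_of_mem hv

theorem coverMap_surjective (N : (Fin n →₀ ℕ) →o Submodule K (G →₀ K)) (a : Fin n →₀ ℕ) :
    ∀ w ∈ N a, ∃ v ∈ freeFamily K (coverDegree N) a, coverMap N v = w := fun w hw => by
  rwa [← map_coverMap N a] at hw

/-- If the graded module of a family is projective, its free cover splits by a linear map that is
independent of the degree: the homogeneous components of any section are compatible with
multiplication by monomials, hence glue. -/
theorem exists_section_of_projective (N : (Fin n →₀ ℕ) →o Submodule K (G →₀ K))
    (hN : Module.Projective (MvPolynomial (Fin n) K) (familyModule N)) :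
    ∃ σ : (G →₀ K) →ₗ[K] ((Σ a : Fin n →₀ ℕ, N a) →₀ K), ∀ a, ∀ v ∈ N a,
      σ v ∈ freeFamily K (coverDegree N) a ∧ coverMap N (σ v) = v := by
  let F := freeFamily K (coverDegree N)
  let π : familyModule F →ₗ[MvPolynomial (Fin n) K] familyModule N :=
    (vecBaseChange (coverMap N)).restrict (vecBaseChange_mem (coverMap_mem N))
  obtain ⟨s, hs⟩ := Module.projective_lifting_property π LinearMap.id
    (vecBaseChange_restrict_surjective (coverMap_mem N) (coverMap_surjective N))
  -- The component of `s` in degree `a`, seen as a map on `N a`.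
  let τ : ∀ a : Fin n →₀ ℕ, N a → ((Σ a : Fin n →₀ ℕ, N a) →₀ K) := fun a v =>
    vecCoeff a (s ⟨vecMonomial a v.1, vecMonomial_mem_familyModule v.2⟩).1
  have hτ : ∀ {a b} (hab : a ≤ b) (v : G →₀ K) (hv : v ∈ N a),
      τ b ⟨v, N.monotone hab hv⟩ = τ a ⟨v, hv⟩ := by
    intro a b hab v hv
    obtain ⟨e, rfl⟩ : ∃ e, b = e + a := ⟨b - a, (tsub_add_cancel_of_le hab).symm⟩
    have : (⟨vecMonomial (e + a) v, vecMonomial_mem_familyModule (N.monotone hab hv)⟩ :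
        familyModule N) = MvPolynomial.monomial e (1 : K) •
          (⟨vecMonomial a v, vecMonomial_mem_familyModule hv⟩ : familyModule N) :=
      Subtype.ext (monomial_smul_vecMonomial a e v).symm
    simp only [τ]
    rw [this, map_smul]
    exact vecCoeff_monomial_smul a e _
  -- As any two degrees have an upper bound, the components define a map on the union of the `N a`,
  -- which is then extended to the whole space.
  have hdir : Directed (· ≤ ·) N := N.monotone.directed_le
  let U : Submodule K (G →₀ K) := ⨆ a, N a
  have hU : ∀ v : U, ∃ a, v.1 ∈ N a := fun v => (Submodule.mem_iSup_of_directed _ hdir).1 v.2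
  choose δ hδ using hU
  have hglue : ∀ (v : U) (a : Fin n →₀ ℕ) (hv : v.1 ∈ N a),
      τ (δ v) ⟨v.1, hδ v⟩ = τ a ⟨v.1, hv⟩ := fun v a hv => by
    rw [← hτ (le_sup_left : δ v ≤ δ v ⊔ a), ← hτ (le_sup_right : a ≤ δ v ⊔ a)]
  let σ₀ : U →ₗ[K] ((Σ a : Fin n →₀ ℕ, N a) →₀ K) :=
    { toFun := fun v => τ (δ v) ⟨v.1, hδ v⟩
      map_add' := fun v w => by
        have hv := N.monotone (le_sup_left : δ v ≤ δ v ⊔ δ w) (hδ v)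
        have hw := N.monotone (le_sup_right : δ w ≤ δ v ⊔ δ w) (hδ w)
        rw [hglue v _ hv, hglue w _ hw, hglue (v + w) _ (Submodule.add_mem _ hv hw)]
        simp only [τ]
        rw [← map_add, ← Submodule.coe_add, ← map_add]
        congr 3
        exact Subtype.ext (map_add _ _ _)
      map_smul' := fun c v => by
        have hv := hδ v
        rw [hglue (c • v) _ (Submodule.smul_mem _ c hv)]
        simp only [τ, RingHom.id_apply]
        have : (⟨vecMonomial (δ v) (c • v.1), vecMonomial_mem_familyModule
            (Submodule.smul_mem _ c hv)⟩ : familyModule N) =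
            (MvPolynomial.C c : MvPolynomial (Fin n) K) •
              (⟨vecMonomial (δ v) v.1, vecMonomial_mem_familyModule hv⟩ : familyModule N) := by
          apply Subtype.ext
          ext1 g
          simp [MvPolynomial.C_mul_monomial, MvPolynomial.smul_monomial]
        have h2 : ∀ f : (Σ a : Fin n →₀ ℕ, N a) →₀ MvPolynomial (Fin n) K,
            vecCoeff (δ v) ((MvPolynomial.C c : MvPolynomial (Fin n) K) • f)
              = c • vecCoeff (δ v) f := by
          intro f
          ext γ
          simp
        exact (congrArg (fun x => vecCoeff (δ v) (s x).1) this).trans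
          ((congrArg (fun x : familyModule F => vecCoeff (δ v) x.1) (map_smul s _ _)).trans (h2 _)) }
  obtain ⟨σ, hσ⟩ := LinearMap.exists_extend σ₀
  refine ⟨σ, fun a v hv => ?_⟩
  have hvU : v ∈ U := Submodule.mem_iSup_of_mem a hv
  have hσv : σ v = τ a ⟨v, hv⟩ := by
    have := LinearMap.congr_fun hσ ⟨v, hvU⟩
    exact this.trans (hglue ⟨v, hvU⟩ a hv)
  rw [hσv]
  refine ⟨(s _).2 a, ?_⟩
  simp only [τ]
  rw [← vecCoeff_vecBaseChange]
  have := congrArg Subtype.val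
    (LinearMap.congr_fun hs ⟨vecMonomial a v, vecMonomial_mem_familyModule hv⟩)
  change vecBaseChange (coverMap N) (s _).1 = vecMonomial a v at this
  rw [this, vecCoeff_vecMonomial_self]

/-- The section of the free cover of `N` restricts to a section of its pullback. -/
theorem projective_familyModule_comp (Θ : (Fin m →₀ ℕ) →o (Fin n →₀ ℕ))
    (hΘ : IsPartiallyResiduated Θ) (N : (Fin n →₀ ℕ) →o Submodule K (G →₀ K))
    (hN : Module.Projective (MvPolynomial (Fin n) K) (familyModule N)) :
    Module.Projective (MvPolynomial (Fin m) K) (familyModule (N.comp Θ)) := by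
  obtain ⟨σ, hσ⟩ := exists_section_of_projective N hN
  have := projective_familyModule_freeFamily_comp (K := K) Θ hΘ (coverDegree N)
  refine Module.Projective.of_split
    ((vecBaseChange σ).restrict (vecBaseChange_mem (F := N.comp Θ)
      (N := (freeFamily K (coverDegree N)).comp Θ) fun a v hv => (hσ (Θ a) v hv).1))
    ((vecBaseChange (coverMap N)).restrict (vecBaseChange_mem
      (F := (freeFamily K (coverDegree N)).comp Θ) (N := N.comp Θ)
      fun a => coverMap_mem N (Θ a))) ?_
  ext1 ⟨f, hf⟩
  refine Subtype.ext (vecCoeff_ext fun a => ?_)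
  change vecCoeff a (vecBaseChange (coverMap N) (vecBaseChange σ f)) = vecCoeff a f
  rw [vecCoeff_vecBaseChange, vecCoeff_vecBaseChange]
  exact (hσ (Θ a) _ (hf a)).2

open CategoryTheory

theorem shortExact_moduleCatMk {R : Type*} [Ring R] {A B C : Type u} [AddCommGroup A]
    [AddCommGroup B] [AddCommGroup C] [Module R A] [Module R B] [Module R C] (i : A →ₗ[R] B)
    (π : B →ₗ[R] C) (hcomp : π.comp i = 0) (hi : Function.Injective i)
    (hπ : Function.Surjective π) (hex : ∀ b, π b = 0 → ∃ a, i a = b) :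
    (ShortComplex.moduleCatMk i π hcomp).ShortExact :=
  { exact := (ShortComplex.moduleCat_exact_iff _).2 hex
    mono_f := (ModuleCat.mono_iff_injective (ModuleCat.ofHom i)).2 hi
    epi_g := (ModuleCat.epi_iff_surjective (ModuleCat.ofHom π)).2 hπ }

/-- Dimension shifting for a cover of families: the kernel is again the module of a family. -/
theorem hasProjectiveDimensionLT_familyModule_iff {h : (Γ →₀ K) →ₗ[K] (G →₀ K)}
    {F : (Fin n →₀ ℕ) →o Submodule K (Γ →₀ K)} {N : (Fin n →₀ ℕ) →o Submodule K (G →₀ K)}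
    (hFN : ∀ a, ∀ v ∈ F a, h v ∈ N a) (hsurj : ∀ a, ∀ w ∈ N a, ∃ v ∈ F a, h v = w)
    (hF : Module.Projective (MvPolynomial (Fin n) K) (familyModule F)) (p : ℕ) :
    HasProjectiveDimensionLT (ModuleCat.of (MvPolynomial (Fin n) K) (familyModule N)) (p + 2) ↔
      HasProjectiveDimensionLT (ModuleCat.of (MvPolynomial (Fin n) K)
        (familyModule (F ⊓ OrderHom.const _ (LinearMap.ker h)))) (p + 1) := by
  let i : familyModule (F ⊓ OrderHom.const _ (LinearMap.ker h))
      →ₗ[MvPolynomial (Fin n) K] familyModule F :=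
    Submodule.inclusion fun f hf a => (hf a).1
  let π : familyModule F →ₗ[MvPolynomial (Fin n) K] familyModule N :=
    (vecBaseChange h).restrict (vecBaseChange_mem hFN)
  have hcomp : π.comp i = 0 := by
    ext1 ⟨f, hf⟩
    refine Subtype.ext (vecCoeff_ext fun a => ?_)
    change vecCoeff a (vecBaseChange h f) = vecCoeff a 0
    rw [vecCoeff_vecBaseChange, map_zero]
    exact (hf a).2
  have hker : ∀ f : familyModule F, π f = 0 → ∃ f', i f' = f := by
    rintro ⟨f, hf⟩ h0
    refine ⟨⟨f, fun a => ⟨hf a, ?_⟩⟩, rfl⟩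
    have : vecBaseChange h f = 0 := congrArg Subtype.val h0
    change h (vecCoeff a f) = 0
    rw [← vecCoeff_vecBaseChange, this, map_zero]
  have hexact := shortExact_moduleCatMk (R := MvPolynomial (Fin n) K)
    (A := familyModule (F ⊓ OrderHom.const _ (LinearMap.ker h))) (B := familyModule F)
    (C := familyModule N) i π hcomp (Submodule.inclusion_injective _)
    (vecBaseChange_restrict_surjective hFN hsurj) hker
  exact hexact.hasProjectiveDimensionLT_X₃_iff p ((IsProjective.iff_projective _).1 hF)

/-- Pulling back along a partially residuated map does not increase the projective dimension. -/
theorem hasProjectiveDimensionLT_familyModule_comp (Θ : (Fin m →₀ ℕ) →o (Fin n →₀ ℕ))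
    (hΘ : IsPartiallyResiduated Θ) (p : ℕ) :
    ∀ {G : Type u} (N : (Fin n →₀ ℕ) →o Submodule K (G →₀ K)),
      HasProjectiveDimensionLT (ModuleCat.of (MvPolynomial (Fin n) K) (familyModule N)) (p + 1) →
      HasProjectiveDimensionLT
        (ModuleCat.of (MvPolynomial (Fin m) K) (familyModule (N.comp Θ))) (p + 1) := by
  induction p with
  | zero =>
    intro G N hN
    rw [zero_add, ← projective_iff_hasProjectiveDimensionLT_one, ← IsProjective.iff_projective]
      at hN ⊢
    exact projective_familyModule_comp Θ hΘ N hN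
  | succ p ih =>
    intro G N hN
    rw [hasProjectiveDimensionLT_familyModule_iff (coverMap_mem N) (coverMap_surjective N)
      (projective_familyModule_freeFamily_comp OrderHom.id (isPartiallyResiduated_id n) _)] at hN
    rw [hasProjectiveDimensionLT_familyModule_iff (h := coverMap N)
      (F := (freeFamily K (coverDegree N)).comp Θ) (N := N.comp Θ)
      (fun a => coverMap_mem N (Θ a)) (fun a => coverMap_surjective N (Θ a))
      (projective_familyModule_freeFamily_comp Θ hΘ _)]
    exact ih _ hN

end GradedFamily

/-! ### Projective dimension of monomial ideals -/

namespace MonomialIdeal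

universe u

open CategoryTheory

variable {K : Type u} [Field K] {m n : ℕ}

open Classical in
/-- The family of a monomial ideal with the exponent set `A`. -/
noncomputable def upperSetFamily (K : Type u) [Field K] {A : Set (Fin n →₀ ℕ)}
    (hA : IsUpperSet A) : (Fin n →₀ ℕ) →o Submodule K (PUnit.{u + 1} →₀ K) where
  toFun a := if a ∈ A then ⊤ else ⊥
  monotone' a b hab := by
    by_cases ha : a ∈ A
    · simp [ha, hA hab ha]
    · simp [ha]

/-- A monomial ideal is the module of the family of its exponent set. -/
noncomputable def IsMonomial.familyModuleEquiv {I : Ideal (MvPolynomial (Fin n) K)}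
    (hI : IsMonomial I) {A : Set (Fin n →₀ ℕ)} (hA : IsUpperSet A) (hIA : exponents I = A) :
    familyModule (upperSetFamily K hA) ≃ₗ[MvPolynomial (Fin n) K] I :=
  let e := Finsupp.uniqueLinearEquiv (MvPolynomial (Fin n) K) (MvPolynomial (Fin n) K)
    PUnit.unit.{u + 1}
  (e.submoduleMap _).trans (LinearEquiv.ofEq _ _ (by
    subst hIA
    ext f
    rw [Submodule.map_equiv_eq_comap_symm, Submodule.mem_comap, mem_familyModule, hI.mem_iff]
    refine forall_congr' fun a => ?_
    by_cases ha : a ∈ exponents I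
    · have h1 : upperSetFamily K hA a = ⊤ := if_pos ha
      simp [h1, ha]
    · have h1 : upperSetFamily K hA a = ⊥ := if_neg ha
      rw [h1, Submodule.mem_bot]
      simp only [ha, imp_false, MvPolynomial.mem_support_iff, not_not]
      constructor
      · intro h
        have := DFunLike.congr_fun h PUnit.unit
        simpa [e, Finsupp.uniqueLinearEquiv_symm_apply] using this
      · intro h
        ext
        simpa [e, Finsupp.uniqueLinearEquiv_symm_apply] using h))

theorem hasProjectiveDimensionLT_congr {R : Type u} [CommRing R] {A B : Type u} [AddCommGroup A]
    [AddCommGroup B] [Module R A] [Module R B] (e : A ≃ₗ[R] B) (p : ℕ) :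
    HasProjectiveDimensionLT (ModuleCat.of R A) p ↔
      HasProjectiveDimensionLT (ModuleCat.of R B) p :=
  ⟨fun _ => hasProjectiveDimensionLT_of_iso e.toModuleIso p,
    fun _ => hasProjectiveDimensionLT_of_iso e.toModuleIso.symm p⟩

theorem hasProjectiveDimensionLT_ideal_of_preimage {θ : (Fin m →₀ ℕ) → (Fin n →₀ ℕ)}
    (hθ : IsPartiallyResiduated θ) {I : Ideal (MvPolynomial (Fin n) K)}
    {J : Ideal (MvPolynomial (Fin m) K)} (hI : IsMonomial I) (hJ : IsMonomial J)
    (hIJ : θ ⁻¹' exponents I = exponents J) {p : ℕ}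
    (h : HasProjectiveDimensionLT (ModuleCat.of (MvPolynomial (Fin n) K) I) (p + 1)) :
    HasProjectiveDimensionLT (ModuleCat.of (MvPolynomial (Fin m) K) J) (p + 1) := by
  let Θ : (Fin m →₀ ℕ) →o (Fin n →₀ ℕ) := ⟨θ, hθ.monotone⟩
  have hA := isUpperSet_exponents I
  have hB : IsUpperSet (θ ⁻¹' exponents I) := hA.preimage hθ.monotone
  rw [← hasProjectiveDimensionLT_congr (R := MvPolynomial (Fin n) K)
    (A := familyModule (upperSetFamily K hA)) (B := I) (hI.familyModuleEquiv hA rfl)] at h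
  rw [← hasProjectiveDimensionLT_congr (R := MvPolynomial (Fin m) K)
    (A := familyModule (upperSetFamily K hB)) (B := J) (hJ.familyModuleEquiv hB hIJ.symm)]
  exact hasProjectiveDimensionLT_familyModule_comp Θ hθ p _ h

/-- The Mayer–Vietoris bound for the projective dimension of a sum of two ideals. -/
theorem hasProjectiveDimensionLT_sup {R : Type u} [CommRing R] (I J : Ideal R) (p : ℕ)
    (hI : HasProjectiveDimensionLT (ModuleCat.of R I) (p + 1))
    (hJ : HasProjectiveDimensionLT (ModuleCat.of R J) (p + 1))
    (hIJ : HasProjectiveDimensionLT (ModuleCat.of R (I ⊓ J : Ideal R)) p) :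
    HasProjectiveDimensionLT (ModuleCat.of R (I ⊔ J : Ideal R)) (p + 1) := by
  have hprod : HasProjectiveDimensionLT (ModuleCat.of R (I × J)) (p + 1) :=
    (shortExact_moduleCatMk (R := R) (A := I) (B := I × J) (C := J) (LinearMap.inl R I J)
      (LinearMap.snd R I J) (LinearMap.snd_comp_inl R I J) LinearMap.inl_injective
      LinearMap.snd_surjective (fun b hb => ⟨b.1, Prod.ext rfl hb.symm⟩)).hasProjectiveDimensionLT_X₂
        (p + 1) hI hJ
  let i : (I ⊓ J : Ideal R) →ₗ[R] I × J :=
    LinearMap.prod (Submodule.inclusion inf_le_left) (-Submodule.inclusion inf_le_right)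
  let π : I × J →ₗ[R] (I ⊔ J : Ideal R) :=
    LinearMap.coprod (Submodule.inclusion le_sup_left) (Submodule.inclusion le_sup_right)
  have hπ : ∀ b : I × J, ((π b : (I ⊔ J : Ideal R)) : R) = (b.1 : R) + b.2 := fun b => rfl
  have hcomp : π.comp i = 0 := by
    ext x
    change (x : R) + -(x : R) = 0
    exact add_neg_cancel _
  have hinj : Function.Injective i := fun x y hxy => by
    have := congrArg (fun z : I × J => (z.1 : R)) hxy
    exact Subtype.ext this
  have hsurj : Function.Surjective π := by
    rintro ⟨x, hx⟩
    obtain ⟨a, ha, b, hb, rfl⟩ := Submodule.mem_sup.1 hx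
    exact ⟨(⟨a, ha⟩, ⟨b, hb⟩), rfl⟩
  have hker : ∀ b : I × J, π b = 0 → ∃ a, i a = b := by
    intro b hb
    have h0 : (b.1 : R) + b.2 = 0 := by rw [← hπ, hb]; rfl
    have h1 : (b.1 : R) = -b.2 := eq_neg_of_add_eq_zero_left h0
    refine ⟨⟨b.1, b.1.2, h1 ▸ J.neg_mem b.2.2⟩, Prod.ext rfl (Subtype.ext ?_)⟩
    change -(b.1 : R) = b.2
    rw [h1, neg_neg]
  exact (shortExact_moduleCatMk (R := R) (A := (I ⊓ J : Ideal R)) (B := I × J)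
    (C := (I ⊔ J : Ideal R)) i π hcomp hinj hsurj hker).hasProjectiveDimensionLT_X₃ p hIJ hprod

theorem span_monomial_inf_span_singleton (s : Set (Fin n →₀ ℕ)) (u : Fin n →₀ ℕ) :
    Ideal.span ((fun a => MvPolynomial.monomial a (1 : K)) '' s) ⊓
      Ideal.span {MvPolynomial.monomial u (1 : K)} =
      Ideal.span ((fun a => MvPolynomial.monomial a (1 : K)) '' ((fun a => a ⊔ u) '' s)) := by
  rw [← Set.image_singleton (f := fun a => MvPolynomial.monomial a (1 : K))]
  ext f
  rw [Ideal.mem_inf]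
  simp_rw [MvPolynomial.mem_ideal_span_monomial_image]
  rw [← forall₂_and]
  refine forall₂_congr fun a _ => ?_
  simp only [Set.mem_singleton_iff, exists_eq_left, Set.exists_mem_image, sup_le_iff]
  exact ⟨fun ⟨⟨b, hb, h1⟩, h2⟩ => ⟨b, hb, h1, h2⟩, fun ⟨b, hb, h1, h2⟩ => ⟨⟨b, hb, h1⟩, h2⟩⟩

/-- Adding a generator `u` to the ideal of `s` is controlled by the Mayer–Vietoris sequence, as the
intersection of the two ideals is generated by the least common multiples of `u` with the elements
of `s`. -/
theorem hasProjectiveDimensionLT_span_monomial (k : ℕ) :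
    ∀ s : Finset (Fin n →₀ ℕ), s.card ≤ k →
      HasProjectiveDimensionLT (ModuleCat.of (MvPolynomial (Fin n) K)
        (Ideal.span ((fun a => MvPolynomial.monomial a (1 : K)) '' (s : Set (Fin n →₀ ℕ))))) k := by
  classical
  induction k with
  | zero =>
    intro s hs
    obtain rfl := Finset.card_eq_zero.1 (Nat.le_zero.1 hs)
    rw [hasProjectiveDimensionLT_zero_iff_isZero, ModuleCat.isZero_iff_subsingleton]
    simp only [Finset.coe_empty, Set.image_empty, Ideal.span_empty]
    infer_instance
  | succ k ih =>
    intro s hs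
    rcases s.eq_empty_or_nonempty with rfl | ⟨u, hu⟩
    · have := ih ∅ (by simp)
      exact hasProjectiveDimensionLT_of_ge _ k _ (Nat.le_succ k)
    rw [← Finset.insert_erase hu, Finset.coe_insert, Set.image_insert_eq, Set.insert_eq,
      Ideal.span_union, sup_comm]
    have hcard : (s.erase u).card ≤ k := by
      rw [Finset.card_erase_of_mem hu]
      omega
    refine hasProjectiveDimensionLT_sup _ _ k ?_ ?_ ?_
    · have := ih _ hcard
      exact hasProjectiveDimensionLT_of_ge _ k _ (Nat.le_succ k)
    · have hu0 : MvPolynomial.monomial u (1 : K) ≠ 0 := by simp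
      rw [← hasProjectiveDimensionLT_congr
        (LinearEquiv.toSpanNonzeroSingleton (MvPolynomial (Fin n) K) _ _ hu0)]
      have : Projective (ModuleCat.of (MvPolynomial (Fin n) K) (MvPolynomial (Fin n) K)) :=
        (IsProjective.iff_projective _).1 inferInstance
      exact hasProjectiveDimensionLT_of_ge _ 1 _ (by omega)
    · rw [span_monomial_inf_span_singleton, ← Finset.coe_image]
      exact ih _ (Finset.card_image_le.trans hcard)

theorem hasProjectiveDimensionLT_quotient_iff {R : Type u} [CommRing R] (I : Ideal R) (p : ℕ) :
    HasProjectiveDimensionLT (ModuleCat.of R (R ⧸ I)) (p + 2) ↔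
      HasProjectiveDimensionLT (ModuleCat.of R I) (p + 1) := by
  refine (shortExact_moduleCatMk (R := R) (A := I) (B := R) (C := R ⧸ I) I.subtype I.mkQ
    ?_ I.injective_subtype I.mkQ_surjective ?_).hasProjectiveDimensionLT_X₃_iff p
    ((IsProjective.iff_projective _).1 (inferInstanceAs (Module.Projective R R)))
  · ext x
    exact Ideal.Quotient.eq_zero_iff_mem.2 x.2
  · intro b hb
    exact ⟨⟨b, Ideal.Quotient.eq_zero_iff_mem.1 hb⟩, rfl⟩

/-- The quotient of a domain by a nonzero proper ideal is not projective, as a section of the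
projection would be annihilated by the ideal. -/
theorem not_hasProjectiveDimensionLT_quotient_one {R : Type u} [CommRing R] [IsDomain R]
    {I : Ideal R} (h0 : I ≠ ⊥) (h1 : I ≠ ⊤) :
    ¬ HasProjectiveDimensionLT (ModuleCat.of R (R ⧸ I)) 1 := by
  intro h
  rw [← projective_iff_hasProjectiveDimensionLT_one, ← IsProjective.iff_projective] at h
  obtain ⟨s, hs⟩ := Module.projective_lifting_property I.mkQ LinearMap.id I.mkQ_surjective
  obtain ⟨x, hx, hx0⟩ := Submodule.exists_mem_ne_zero_of_ne_bot h0
  have hsx : x • s (I.mkQ 1) = 0 := by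
    rw [← map_smul, ← map_smul, smul_eq_mul, mul_one,
      show I.mkQ x = 0 from Ideal.Quotient.eq_zero_iff_mem.2 hx, map_zero]
  have hs0 : s (I.mkQ 1) = 0 := (smul_eq_zero.1 hsx).resolve_left hx0
  have := LinearMap.congr_fun hs (I.mkQ 1)
  rw [LinearMap.comp_apply, hs0, map_zero] at this
  exact h1 ((Ideal.eq_top_iff_one I).2 (Ideal.Quotient.eq_zero_iff_mem.1 this.symm))

theorem pdimIdeal_le_iff (I : Ideal (MvPolynomial (Fin n) K)) (p : ℕ) :
    pdimIdeal I ≤ ((p : ℕ∞) : WithBot ℕ∞) ↔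
      HasProjectiveDimensionLT (ModuleCat.of (MvPolynomial (Fin n) K) I) (p + 1) :=
  projectiveDimension_le_iff _ p

theorem pdimQuotient_le_iff {I : Ideal (MvPolynomial (Fin n) K)} (h0 : I ≠ ⊥) (h1 : I ≠ ⊤)
    (p : ℕ) : pdimQuotient I ≤ ((p : ℕ∞) : WithBot ℕ∞) ↔
      ∃ q, p = q + 1 ∧
        HasProjectiveDimensionLT (ModuleCat.of (MvPolynomial (Fin n) K) I) (q + 1) := by
  refine (projectiveDimension_le_iff _ p).trans ?_
  rcases p with _ | q
  · simp [not_hasProjectiveDimensionLT_quotient_one h0 h1]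
  · simp [hasProjectiveDimensionLT_quotient_iff]

end MonomialIdeal

/-! ### Join-preserving surjections between atomistic lattices -/

namespace AtomisticLattice

variable {k : ℕ} {L L' : AtomisticLattice k} {φ : L.carrier → L'.carrier}

theorem map_bot_of_surjective (hφ : ∀ P Q, φ (P ⊔ Q) = φ P ⊔ φ Q)
    (hs : Function.Surjective φ) : φ ⊥ = ⊥ := by
  obtain ⟨x, hx⟩ := hs ⊥
  rw [eq_bot_iff, ← hx]
  conv_rhs => rw [← bot_sup_eq x, hφ]
  exact le_sup_left

theorem map_finset_sup_of_surjective (hφ : ∀ P Q, φ (P ⊔ Q) = φ P ⊔ φ Q)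
    (hs : Function.Surjective φ) {ι : Type*} (s : Finset ι) (f : ι → L.carrier) :
    φ (s.sup f) = s.sup fun i => φ (f i) := by
  let F : SupBotHom L.carrier L'.carrier := ⟨⟨φ, hφ⟩, map_bot_of_surjective hφ hs⟩
  exact map_finset_sup F s f

theorem exists_finset_atoms (x : L.carrier) :
    ∃ s : Finset L.carrier, (∀ a ∈ s, IsAtom a) ∧ s.sup id = x := by
  obtain ⟨s, hs, ha⟩ := IsAtomistic.isLUB_atoms x
  refine ⟨(Set.toFinite s).toFinset, fun a h => ha a (by simpa using h), ?_⟩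
  refine IsLUB.unique ?_ hs
  have := Finset.isLUB_sup_id (s := (Set.toFinite s).toFinset)
  rwa [Set.Finite.coe_toFinset] at this

/-- Every atom of the target is the image of an atom: write a preimage as a join of atoms. -/
theorem exists_atom_map_eq (hφ : ∀ P Q, φ (P ⊔ Q) = φ P ⊔ φ Q) (hs : Function.Surjective φ)
    {a' : L'.carrier} (ha' : IsAtom a') : ∃ a, IsAtom a ∧ φ a = a' := by
  obtain ⟨x, rfl⟩ := hs a'
  obtain ⟨s, hsa, rfl⟩ := exists_finset_atoms x
  have hmap := map_finset_sup_of_surjective hφ hs s id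
  have hex : ∃ a ∈ s, φ a ≠ ⊥ := by
    by_contra! hcon
    refine ha'.1 ?_
    rw [hmap, Finset.sup_eq_bot_iff]
    exact hcon
  obtain ⟨a, has, ha⟩ := hex
  refine ⟨a, hsa a has, (ha'.le_iff.1 ?_).resolve_left ha⟩
  rw [hmap]
  exact Finset.le_sup (f := fun i => φ (id i)) has

/-- As both lattices have the same number of atoms, no atom can be sent to the bottom element. -/
theorem map_atom_ne_bot (hφ : ∀ P Q, φ (P ⊔ Q) = φ P ⊔ φ Q) (hs : Function.Surjective φ)
    {a : L.carrier} (ha : IsAtom a) : φ a ≠ ⊥ := by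
  intro h0
  have hsub : {b : L'.carrier | IsAtom b} ⊆ φ '' ({b : L.carrier | IsAtom b} \ {a}) := by
    intro b hb
    obtain ⟨c, hc, rfl⟩ := exists_atom_map_eq hφ hs hb
    refine ⟨c, ⟨hc, ?_⟩, rfl⟩
    rintro rfl
    exact hb.1 h0
  have h1 := Set.ncard_le_ncard hsub (Set.toFinite _)
  have h2 := Set.ncard_image_le (f := φ) (Set.toFinite ({b : L.carrier | IsAtom b} \ {a}))
  have h3 := Set.ncard_sdiff_singleton_lt_of_mem (s := {b : L.carrier | IsAtom b}) ha
    (Set.toFinite _)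
  rw [L.ncard_atoms] at h3
  rw [L'.ncard_atoms] at h1
  omega

end AtomisticLattice

/-! ### Monomial ideals and lattices -/

namespace MonomialIdeal

universe u

variable {K : Type u} [Field K] {m n k : ℕ}

theorem zero_mem_lcmLattice (I : Ideal (MvPolynomial (Fin n) K)) : 0 ∈ lcmLattice I :=
  ⟨∅, by simp, by simp [bot_eq_zero]⟩

theorem mem_lcmLattice_of_mem_minGens {I : Ideal (MvPolynomial (Fin n) K)} {u : Fin n →₀ ℕ}
    (hu : u ∈ minGens I) : u ∈ lcmLattice I :=
  ⟨{u}, by simpa using hu, by simp⟩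

theorem finset_sup_mem_lcmLattice {I : Ideal (MvPolynomial (Fin n) K)} {ι : Type*} (s : Finset ι)
    (f : ι → Fin n →₀ ℕ) (hf : ∀ i ∈ s, f i ∈ lcmLattice I) : s.sup f ∈ lcmLattice I := by
  classical
  refine Finset.sup_induction (p := fun x => x ∈ lcmLattice I) ?_ ?_ hf
  · exact zero_mem_lcmLattice I
  · rintro _ ⟨t, ht, rfl⟩ _ ⟨t', ht', rfl⟩
    exact ⟨t ∪ t', by simp [ht, ht'], by rw [Finset.sup_union]⟩

theorem exists_minGens_le_of_mem_lcmLattice {I : Ideal (MvPolynomial (Fin n) K)}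
    {x : Fin n →₀ ℕ} (hx : x ∈ lcmLattice I) (h0 : x ≠ 0) : ∃ u ∈ minGens I, u ≤ x := by
  obtain ⟨t, ht, rfl⟩ := hx
  rcases t.eq_empty_or_nonempty with rfl | ⟨u, hu⟩
  · exact (h0 (by simp [bot_eq_zero])).elim
  · exact ⟨u, ht hu, Finset.le_sup (f := id) hu⟩

theorem exponents_eq_biUnion_minGens (I : Ideal (MvPolynomial (Fin n) K)) :
    exponents I = ⋃ u ∈ minGens I, Set.Ici u := by
  ext a
  simp only [Set.mem_iUnion, Set.mem_Ici, exists_prop]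
  constructor
  · intro ha
    obtain ⟨u, hua, hu⟩ := exists_minimal_le_of_wellFoundedLT
      (fun b => MvPolynomial.monomial b (1 : K) ∈ I) a ha
    exact ⟨u, hu, hua⟩
  · rintro ⟨u, hu, hua⟩
    exact isUpperSet_exponents I hua hu.1

theorem IsMonomial.eq_span_minGens {I : Ideal (MvPolynomial (Fin n) K)} (hI : IsMonomial I) :
    I = Ideal.span ((fun a => MvPolynomial.monomial a (1 : K)) '' minGens I) := by
  ext f
  rw [hI.mem_iff, IsMonomial.mem_iff ⟨_, rfl⟩, exponents_span, ← exponents_eq_biUnion_minGens]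

section Realizes

variable {L : AtomisticLattice k} {I : Ideal (MvPolynomial (Fin n) K)}

theorem finite_minGens (e : lcmLattice I ≃o L.carrier) : (minGens I).Finite := by
  have : Finite (lcmLattice I) := Finite.of_equiv _ e.symm.toEquiv
  exact (Set.toFinite (lcmLattice I)).subset fun u => mem_lcmLattice_of_mem_minGens

theorem equiv_zero (e : lcmLattice I ≃o L.carrier) : e ⟨0, zero_mem_lcmLattice I⟩ = ⊥ := by
  rw [eq_bot_iff, ← e.apply_symm_apply ⊥, e.le_iff_le]
  exact (zero_le : (0 : Fin n →₀ ℕ) ≤ _)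

theorem exists_minGens_ne_zero (hk : 1 ≤ k) (e : lcmLattice I ≃o L.carrier) :
    ∃ u ∈ minGens I, u ≠ 0 := by
  by_contra! hcon
  have hatom : {a : L.carrier | IsAtom a}.Nonempty := by
    rw [← Set.ncard_pos, L.ncard_atoms]
    exact hk
  obtain ⟨a, ha⟩ := hatom
  refine ha.1 ?_
  rw [← equiv_zero e, ← e.symm_apply_eq]
  refine Subtype.ext ?_
  by_contra h0
  obtain ⟨t, ht, htx⟩ := (e.symm a).2
  refine h0 (htx.trans (eq_bot_iff.2 (Finset.sup_le fun u hu => ?_)))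
  exact (hcon u (ht hu)).le

/-- A lattice with an atom is not the lcm-lattice of the unit ideal, whose only generator is `1`. -/
theorem zero_notMem_exponents (hk : 1 ≤ k) (e : lcmLattice I ≃o L.carrier) :
    0 ∉ exponents I := by
  intro h0
  obtain ⟨u, hu, hu0⟩ := exists_minGens_ne_zero hk e
  exact hu0 (le_antisymm (hu.2 h0 zero_le) zero_le)

theorem isAtom_equiv_minGens (hk : 1 ≤ k) (e : lcmLattice I ≃o L.carrier) {u : Fin n →₀ ℕ}
    (hu : u ∈ minGens I) : IsAtom (e ⟨u, mem_lcmLattice_of_mem_minGens hu⟩) := by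
  constructor
  · rw [← equiv_zero e, e.injective.ne_iff]
    intro h
    have h0 : u = 0 := congrArg Subtype.val h
    exact zero_notMem_exponents hk e (h0 ▸ hu.1)
  · intro y hy
    rw [← e.apply_symm_apply y, e.lt_iff_lt] at hy
    rw [← equiv_zero e, ← e.symm_apply_eq]
    refine Subtype.ext ?_
    by_contra h0
    obtain ⟨v, hv, hvx⟩ := exists_minGens_le_of_mem_lcmLattice (e.symm y).2 h0
    have hlt : v < u := lt_of_le_of_lt hvx hy
    exact absurd (hu.2 hv.1 hlt.le) hlt.not_ge

theorem exists_minGens_equiv_eq (hk : 1 ≤ k) (e : lcmLattice I ≃o L.carrier) {a : L.carrier}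
    (ha : IsAtom a) :
    ∃ (u : Fin n →₀ ℕ) (hu : u ∈ minGens I), e ⟨u, mem_lcmLattice_of_mem_minGens hu⟩ = a := by
  have h0 : (e.symm a : Fin n →₀ ℕ) ≠ 0 := by
    intro h
    refine ha.1 ?_
    rw [← equiv_zero e, ← e.symm_apply_eq]
    exact Subtype.ext h
  obtain ⟨u, hu, hux⟩ := exists_minGens_le_of_mem_lcmLattice (e.symm a).2 h0
  refine ⟨u, hu, (ha.le_iff.1 ?_).resolve_left (isAtom_equiv_minGens hk e hu).1⟩
  rw [← e.le_symm_apply]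
  exact hux

/-- A surjection of lcm-lattices induces a partially residuated map in the other direction that
pulls back one ideal to the other. -/
theorem exists_isPartiallyResiduated_of_dominates (hk : 1 ≤ k) {L' : AtomisticLattice k}
    {J : Ideal (MvPolynomial (Fin m) K)} (e : lcmLattice I ≃o L.carrier)
    (e' : lcmLattice J ≃o L'.carrier) (hLL' : L.Dominates L') :
    ∃ θ : (Fin m →₀ ℕ) → (Fin n →₀ ℕ), IsPartiallyResiduated θ ∧
      θ ⁻¹' exponents I = exponents J := by
  obtain ⟨φ, hφ, hs⟩ := hLL'
  have hmono : Monotone φ := fun x y hxy => by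
    rw [← sup_eq_right, ← hφ, sup_eq_right.2 hxy]
  have := (finite_minGens e).to_subtype
  let E : minGens I → L.carrier := fun i => e ⟨i.1, mem_lcmLattice_of_mem_minGens i.2⟩
  let g' : minGens I → (Fin m →₀ ℕ) := fun i => e'.symm (φ (E i))
  have hg' : ∀ i, g' i ∈ lcmLattice J := fun i => (e'.symm (φ (E i))).2
  have hH : ∀ (i : minGens I) (T : Finset (minGens I)),
      (i : Fin n →₀ ℕ) ≤ T.sup Subtype.val → g' i ≤ T.sup g' := by
    intro i T hi
    have hT : T.sup Subtype.val ∈ lcmLattice I :=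
      finset_sup_mem_lcmLattice T _ fun j _ => mem_lcmLattice_of_mem_minGens j.2
    have hT' : T.sup g' ∈ lcmLattice J := finset_sup_mem_lcmLattice T _ fun j _ => hg' j
    -- Joins in the lcm-lattices are computed in the exponent vectors, so the assumption transfers to
    -- `L`, then to `L'` by `φ`, and back.
    have h1 : E i ≤ T.sup E := by
      refine le_trans (e.le_iff_le.2 (show _ ≤ (⟨_, hT⟩ : lcmLattice I) from hi)) ?_
      rw [← e.le_symm_apply]
      refine Finset.sup_le (f := (Subtype.val : minGens I → _)) fun j hj => ?_
      have : (⟨j.1, mem_lcmLattice_of_mem_minGens j.2⟩ : lcmLattice I) ≤ e.symm (T.sup E) := by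
        rw [e.le_symm_apply]
        exact Finset.le_sup (f := E) hj
      exact this
    have h2 : φ (E i) ≤ e' ⟨T.sup g', hT'⟩ := by
      refine (hmono h1).trans ?_
      rw [AtomisticLattice.map_finset_sup_of_surjective hφ hs]
      refine Finset.sup_le fun j hj => ?_
      rw [← e'.symm_apply_le]
      exact Finset.le_sup (f := g') hj
    rw [← e'.symm_apply_le] at h2
    exact h2
  obtain ⟨θ, hθ, hpre⟩ := exists_isPartiallyResiduated (fun i : minGens I => (i : Fin n →₀ ℕ)) g' hH
  refine ⟨θ, hθ, ?_⟩
  rw [exponents_eq_biUnion_minGens I, Set.biUnion_eq_iUnion, Set.preimage_iUnion]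
  simp_rw [hpre]
  apply le_antisymm
  · refine Set.iUnion_subset fun i b hb => ?_
    have hne : g' i ≠ 0 := by
      intro h0
      refine AtomisticLattice.map_atom_ne_bot hφ hs (isAtom_equiv_minGens hk e i.2) ?_
      rw [← equiv_zero e', ← e'.symm_apply_eq]
      exact Subtype.ext h0
    obtain ⟨w, hw, hwg⟩ := exists_minGens_le_of_mem_lcmLattice (hg' i) hne
    exact isUpperSet_exponents J (hwg.trans hb) hw.1
  · rw [exponents_eq_biUnion_minGens J]
    refine Set.iUnion₂_subset fun w hw b hb => ?_
    obtain ⟨a, ha, haw⟩ := AtomisticLattice.exists_atom_map_eq hφ hs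
      (isAtom_equiv_minGens hk e' hw)
    obtain ⟨u, hu, rfl⟩ := exists_minGens_equiv_eq hk e ha
    refine Set.mem_iUnion.2 ⟨⟨u, hu⟩, ?_⟩
    have : g' ⟨u, hu⟩ = w := by
      change ((e'.symm (φ (e _)) : lcmLattice J) : Fin m →₀ ℕ) = w
      rw [haw, e'.symm_apply_apply]
    exact this ▸ hb

theorem exists_hasStanleyPartition_exponents (e : lcmLattice I ≃o L.carrier) :
    ∃ c, HasStanleyPartition c (exponents I) := by
  have := HasStanleyPartition.biUnion_Ici (finite_minGens e).toFinset
  rw [exponents_eq_biUnion_minGens]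
  simp only [Set.Finite.mem_toFinset] at this
  exact ⟨_, this⟩

theorem exists_hasStanleyPartition_compl_exponents (e : lcmLattice I ≃o L.carrier) :
    ∃ c, HasStanleyPartition c (exponents I)ᶜ := by
  have := HasStanleyPartition.compl_biUnion_Ici (finite_minGens e).toFinset
  rw [exponents_eq_biUnion_minGens]
  simp only [Set.Finite.mem_toFinset] at this
  exact ⟨_, this⟩

theorem ne_bot_of_equiv (hk : 1 ≤ k) (e : lcmLattice I ≃o L.carrier) : I ≠ ⊥ := by
  rintro rfl
  obtain ⟨u, hu, -⟩ := exists_minGens_ne_zero hk e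
  have h0 : MvPolynomial.monomial u (1 : K) = 0 := hu.1
  exact one_ne_zero (MvPolynomial.monomial_eq_zero.1 h0)

theorem ne_top_of_equiv (hk : 1 ≤ k) (e : lcmLattice I ≃o L.carrier) : I ≠ ⊤ := by
  rintro rfl
  exact zero_notMem_exponents hk e
    (Submodule.mem_top : MvPolynomial.monomial 0 (1 : K) ∈ (⊤ : Ideal (MvPolynomial (Fin n) K)))

end Realizes

/-! ### Every finite atomistic lattice is an lcm-lattice -/

/-- The squarefree monomial attached to `p ∈ L`: the product of the variables `x ∈ L` with
`¬ p ≤ x`. -/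
noncomputable def latticeMonomial (L : AtomisticLattice k) (p : L.carrier) :
    Fin (Nat.card L.carrier) →₀ ℕ :=
  open Classical in
  Finsupp.equivFunOnFinite.symm fun j =>
    if p ≤ (Finite.equivFin L.carrier).symm j then 0 else 1

theorem latticeMonomial_le_iff (L : AtomisticLattice k) (p q : L.carrier) :
    latticeMonomial L p ≤ latticeMonomial L q ↔ p ≤ q := by
  classical
  constructor
  · intro h
    have := h (Finite.equivFin L.carrier q)
    by_contra hpq
    simp [latticeMonomial, hpq] at this
  · intro h j
    simp only [latticeMonomial, Finsupp.equivFunOnFinite_symm_apply_apply]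
    split_ifs with h1 h2
    · exact le_rfl
    · exact zero_le_one
    · exact (h1 (h.trans (by assumption))).elim
    · exact le_rfl

theorem latticeMonomial_finset_sup (L : AtomisticLattice k) (s : Finset L.carrier) :
    latticeMonomial L (s.sup id) = s.sup (latticeMonomial L) := by
  classical
  induction s using Finset.induction_on with
  | empty =>
    ext j
    simp [latticeMonomial, bot_eq_zero]
  | insert a s _ ih =>
    rw [Finset.sup_insert, Finset.sup_insert, ← ih]
    ext j
    simp only [latticeMonomial, id, Finsupp.equivFunOnFinite_symm_apply_apply, Finsupp.sup_apply,
      sup_le_iff]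
    split_ifs <;> simp_all

theorem exists_realizes (K : Type u) [Field K] (L : AtomisticLattice k) :
    ∃ (n : ℕ) (I : Ideal (MvPolynomial (Fin n) K)), Realizes I L := by
  classical
  let I : Ideal (MvPolynomial (Fin (Nat.card L.carrier)) K) := Ideal.span
    ((fun a => MvPolynomial.monomial a (1 : K)) '' (latticeMonomial L '' {a | IsAtom a}))
  have hexp : ∀ b, MvPolynomial.monomial b (1 : K) ∈ I ↔
      ∃ a, IsAtom a ∧ latticeMonomial L a ≤ b := by
    intro b
    change b ∈ exponents I ↔ _
    rw [exponents_span]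
    simp
  have hmin : minGens I = latticeMonomial L '' {a | IsAtom a} := by
    ext b
    constructor
    · intro hb
      obtain ⟨a, ha, hab⟩ := (hexp b).1 hb.1
      exact ⟨a, ha, hab.antisymm (hb.2 ((hexp _).2 ⟨a, ha, le_rfl⟩) hab)⟩
    · rintro ⟨a, ha, rfl⟩
      refine ⟨(hexp _).2 ⟨a, ha, le_rfl⟩, fun c hc hca => ?_⟩
      obtain ⟨a', ha', hac⟩ := (hexp c).1 hc
      have hle : a' ≤ a := (latticeMonomial_le_iff L a' a).1 (hac.trans hca)
      rwa [← (ha.le_iff.1 hle).resolve_left ha'.1]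
  have hlcm : lcmLattice I = Set.range (latticeMonomial L) := by
    ext b
    constructor
    · rintro ⟨t, ht, rfl⟩
      rw [hmin] at ht
      obtain ⟨s, -, rfl⟩ := Finset.subset_set_image_iff.1 ht
      exact ⟨s.sup id, by rw [latticeMonomial_finset_sup, Finset.sup_image, Function.id_comp]⟩
    · rintro ⟨p, rfl⟩
      obtain ⟨s, hs, rfl⟩ := AtomisticLattice.exists_finset_atoms p
      refine ⟨s.image (latticeMonomial L), ?_, ?_⟩
      · rw [hmin, Finset.coe_image]
        exact Set.image_mono hs
      · rw [latticeMonomial_finset_sup, Finset.sup_image, Function.id_comp]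
  let ψ : L.carrier ↪o (Fin (Nat.card L.carrier) →₀ ℕ) :=
    OrderEmbedding.ofMapLEIff (latticeMonomial L) (latticeMonomial_le_iff L)
  refine ⟨_, I, ⟨_, rfl⟩, ⟨?_⟩⟩
  exact (OrderIso.setCongr _ _ hlcm).trans ψ.orderIso.symm

/-! ### Invariants of lattices -/

/-- An invariant of monomial ideals with values in the image of `ℕ` that decreases along surjections
of lcm-lattices descends to a monotone function on isomorphism classes of lattices. -/
theorem exists_latticeClass_function {V : Type*} [PartialOrder V] (cast : ℕ → V)
    (hcast : ∀ a b, cast a ≤ cast b ↔ a ≤ b)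
    (inv : ∀ n : ℕ, Ideal (MvPolynomial (Fin n) K) → V)
    (hfin : ∀ (L : AtomisticLattice k) (n : ℕ) (I : Ideal (MvPolynomial (Fin n) K)),
      Realizes I L → ∃ d : ℕ, inv n I = cast d)
    (hmono : ∀ (L L' : AtomisticLattice k) (n m : ℕ) (I : Ideal (MvPolynomial (Fin n) K))
      (J : Ideal (MvPolynomial (Fin m) K)), Realizes I L → Realizes J L' → L.Dominates L' →
        inv m J ≤ inv n I) :
    ∃ F : LatticeClass k → ℕ,
      (∀ (L : AtomisticLattice k) (n : ℕ) (I : Ideal (MvPolynomial (Fin n) K)),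
        Realizes I L → inv n I = cast (F L.toClass)) ∧ Monotone F := by
  have hex : ∀ L : AtomisticLattice k, ∃ d : ℕ,
      ∃ (n : ℕ) (I : Ideal (MvPolynomial (Fin n) K)), Realizes I L ∧ inv n I = cast d := by
    intro L
    obtain ⟨n, I, hI⟩ := exists_realizes K L
    obtain ⟨d, hd⟩ := hfin L n I hI
    exact ⟨d, n, I, hI, hd⟩
  choose d hd using hex
  have hF : ∀ (L : AtomisticLattice k) (n : ℕ) (I : Ideal (MvPolynomial (Fin n) K)),
      Realizes I L → inv n I = cast (d (Quotient.out L.toClass)) := by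
    intro L n I hI
    obtain ⟨m, J, hJ, hJd⟩ := hd (Quotient.out L.toClass)
    have heq : Quotient.out L.toClass ≈ L := Quotient.mk_out L
    rw [← hJd]
    exact le_antisymm (hmono _ _ _ _ _ _ hJ hI (AtomisticLattice.Dominates.of_equiv heq))
      (hmono _ _ _ _ _ _ hI hJ (AtomisticLattice.Dominates.of_equiv (Setoid.symm heq)))
  refine ⟨fun c => d c.out, hF, fun x y hxy => ?_⟩
  induction x using Quotient.inductionOn with
  | h L' =>
    induction y using Quotient.inductionOn with
    | h L =>
      obtain ⟨n, I, hI⟩ := exists_realizes K L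
      obtain ⟨m, J, hJ⟩ := exists_realizes K L'
      have := hmono L L' n m I J hI hJ ((AtomisticLattice.toClass_le_toClass L L').1 hxy)
      rw [hF L n I hI, hF L' m J hJ, hcast] at this
      exact this

theorem exists_stanleyProjDim_eq {M : Type*} [AddCommGroup M] [Module (MvPolynomial (Fin n) K) M]
    [Module K M] [IsScalarTower K (MvPolynomial (Fin n) K) M] (ℳ : (Fin n → ℤ) → Submodule K M) :
    ∃ d : ℕ, stanleyProjDim ℳ = (d : ℕ∞) := by
  have hle : stanleyProjDim ℳ ≤ n := tsub_le_self
  obtain ⟨d, hd⟩ := ENat.ne_top_iff_exists.1 (hle.trans_lt (ENat.natCast_lt_top n)).ne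
  exact ⟨d, hd.symm⟩

theorem exists_eq_natCast_of_le {x : WithBot ℕ∞} (h0 : x ≠ ⊥) {p : ℕ}
    (hx : x ≤ ((p : ℕ∞) : WithBot ℕ∞)) : ∃ d : ℕ, x = ((d : ℕ∞) : WithBot ℕ∞) := by
  induction x with
  | bot => exact (h0 rfl).elim
  | coe y =>
    rw [WithBot.coe_le_coe] at hx
    obtain ⟨d, hd⟩ := ENat.ne_top_iff_exists.1 (hx.trans_lt (ENat.natCast_lt_top p)).ne
    exact ⟨d, by rw [hd]⟩

theorem exists_hasProjectiveDimensionLT {L : AtomisticLattice k}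
    {I : Ideal (MvPolynomial (Fin n) K)} (hI : IsMonomial I) (e : lcmLattice I ≃o L.carrier) :
    ∃ p : ℕ, CategoryTheory.HasProjectiveDimensionLT
      (ModuleCat.of (MvPolynomial (Fin n) K) I) (p + 1) := by
  have := hasProjectiveDimensionLT_span_monomial (K := K) _ (finite_minGens e).toFinset le_rfl
  rw [Set.Finite.coe_toFinset, ← hI.eq_span_minGens] at this
  exact ⟨(finite_minGens e).toFinset.card, CategoryTheory.hasProjectiveDimensionLT_of_ge _
    (finite_minGens e).toFinset.card _ (Nat.le_succ _)⟩

theorem exists_pdimIdeal_eq (hk : 1 ≤ k) {L : AtomisticLattice k}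
    {I : Ideal (MvPolynomial (Fin n) K)} (h : Realizes I L) :
    ∃ d : ℕ, pdimIdeal I = ((d : ℕ∞) : WithBot ℕ∞) := by
  obtain ⟨hI, ⟨e⟩⟩ := h
  obtain ⟨p, hp⟩ := exists_hasProjectiveDimensionLT hI e
  refine exists_eq_natCast_of_le (fun hbot => ?_) ((pdimIdeal_le_iff I p).2 hp)
  rw [pdimIdeal, CategoryTheory.projectiveDimension_eq_bot_iff,
    ModuleCat.isZero_iff_subsingleton] at hbot
  exact ne_bot_of_equiv hk e ((Submodule.subsingleton_iff_eq_bot).1 hbot)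

theorem exists_pdimQuotient_eq (hk : 1 ≤ k) {L : AtomisticLattice k}
    {I : Ideal (MvPolynomial (Fin n) K)} (h : Realizes I L) :
    ∃ d : ℕ, pdimQuotient I = ((d : ℕ∞) : WithBot ℕ∞) := by
  obtain ⟨hI, ⟨e⟩⟩ := h
  obtain ⟨p, hp⟩ := exists_hasProjectiveDimensionLT hI e
  refine exists_eq_natCast_of_le (fun hbot => ?_)
    ((pdimQuotient_le_iff (ne_bot_of_equiv hk e) (ne_top_of_equiv hk e) (p + 1)).2 ⟨p, rfl, hp⟩)
  rw [pdimQuotient, CategoryTheory.projectiveDimension_eq_bot_iff,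
    ModuleCat.isZero_iff_subsingleton] at hbot
  exact ne_top_of_equiv hk e (Ideal.Quotient.subsingleton_iff.1 hbot)

end MonomialIdeal

theorem corollary4p1 (K : Type*) [Field K] (k : ℕ) (hk : 1 ≤ k) :
    (∀ L : AtomisticLattice k,
      ∃ (n : ℕ) (I : Ideal (MvPolynomial (Fin n) K)), MonomialIdeal.Realizes I L) ∧
    ∃ spdim₁ spdim₂ pdim₁ pdim₂ : LatticeClass k → ℕ,
      (∀ (L : AtomisticLattice k) (n : ℕ) (I : Ideal (MvPolynomial (Fin n) K)),
        MonomialIdeal.Realizes I L →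
        MonomialIdeal.spdimIdeal I = (spdim₁ L.toClass : ℕ∞) ∧
        MonomialIdeal.spdimQuotient I = (spdim₂ L.toClass : ℕ∞) ∧
        MonomialIdeal.pdimIdeal I = ((pdim₁ L.toClass : ℕ∞) : WithBot ℕ∞) ∧
        MonomialIdeal.pdimQuotient I = ((pdim₂ L.toClass : ℕ∞) : WithBot ℕ∞)) ∧
      Monotone spdim₁ ∧ Monotone spdim₂ ∧ Monotone pdim₁ ∧ Monotone pdim₂ := by
  open MonomialIdeal in
  refine ⟨exists_realizes K, ?_⟩
  obtain ⟨F₁, h₁, hm₁⟩ := exists_latticeClass_function (K := K) (k := k)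
    (fun d => (d : ℕ∞)) (fun a b => Nat.cast_le) (fun _ I => spdimIdeal I)
    (fun L n I _ => exists_stanleyProjDim_eq (idealGrading I)) (by
      rintro L L' n m I J ⟨hI, ⟨e⟩⟩ ⟨hJ, ⟨e'⟩⟩ hLL'
      obtain ⟨θ, hθ, hIJ⟩ := exists_isPartiallyResiduated_of_dominates hk e e' hLL'
      obtain ⟨d, hd⟩ := exists_stanleyProjDim_eq (idealGrading I)
      have h := (hI.isMonomialBasis_ideal.stanleyProjDim_le_iff
        (exists_hasStanleyPartition_exponents e) d).1 hd.le
      change stanleyProjDim (idealGrading J) ≤ stanleyProjDim (idealGrading I)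
      rw [hd, hJ.isMonomialBasis_ideal.stanleyProjDim_le_iff
        (exists_hasStanleyPartition_exponents e'), ← hIJ]
      exact h.preimage hθ)
  obtain ⟨F₂, h₂, hm₂⟩ := exists_latticeClass_function (K := K) (k := k)
    (fun d => (d : ℕ∞)) (fun a b => Nat.cast_le) (fun _ I => spdimQuotient I)
    (fun L n I _ => exists_stanleyProjDim_eq (quotientGrading I)) (by
      rintro L L' n m I J ⟨hI, ⟨e⟩⟩ ⟨hJ, ⟨e'⟩⟩ hLL'
      obtain ⟨θ, hθ, hIJ⟩ := exists_isPartiallyResiduated_of_dominates hk e e' hLL'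
      obtain ⟨d, hd⟩ := exists_stanleyProjDim_eq (quotientGrading I)
      have h := (hI.isMonomialBasis_quotient.stanleyProjDim_le_iff
        (exists_hasStanleyPartition_compl_exponents e) d).1 hd.le
      change stanleyProjDim (quotientGrading J) ≤ stanleyProjDim (quotientGrading I)
      rw [hd, hJ.isMonomialBasis_quotient.stanleyProjDim_le_iff
        (exists_hasStanleyPartition_compl_exponents e'), ← hIJ, ← Set.preimage_compl]
      exact h.preimage hθ)
  have hcast : ∀ a b : ℕ, ((a : ℕ∞) : WithBot ℕ∞) ≤ ((b : ℕ∞) : WithBot ℕ∞) ↔ a ≤ b :=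
    fun a b => by rw [WithBot.coe_le_coe, Nat.cast_le]
  obtain ⟨F₃, h₃, hm₃⟩ := exists_latticeClass_function (K := K) (k := k)
    (fun d => ((d : ℕ∞) : WithBot ℕ∞)) hcast (fun _ I => pdimIdeal I)
    (fun L n I => exists_pdimIdeal_eq hk) (by
      intro L L' n m I J hIL hJL hLL'
      obtain ⟨d, hd⟩ := exists_pdimIdeal_eq hk hIL
      obtain ⟨hI, ⟨e⟩⟩ := hIL
      obtain ⟨hJ, ⟨e'⟩⟩ := hJL
      obtain ⟨θ, hθ, hIJ⟩ := exists_isPartiallyResiduated_of_dominates hk e e' hLL'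
      have h := (pdimIdeal_le_iff I d).1 hd.le
      change pdimIdeal J ≤ pdimIdeal I
      rw [hd, pdimIdeal_le_iff]
      exact hasProjectiveDimensionLT_ideal_of_preimage hθ hI hJ hIJ h)
  obtain ⟨F₄, h₄, hm₄⟩ := exists_latticeClass_function (K := K) (k := k)
    (fun d => ((d : ℕ∞) : WithBot ℕ∞)) hcast (fun _ I => pdimQuotient I)
    (fun L n I => exists_pdimQuotient_eq hk) (by
      intro L L' n m I J hIL hJL hLL'
      obtain ⟨d, hd⟩ := exists_pdimQuotient_eq hk hIL
      obtain ⟨hI, ⟨e⟩⟩ := hIL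
      obtain ⟨hJ, ⟨e'⟩⟩ := hJL
      obtain ⟨θ, hθ, hIJ⟩ := exists_isPartiallyResiduated_of_dominates hk e e' hLL'
      obtain ⟨q, hq, h⟩ :=
        (pdimQuotient_le_iff (ne_bot_of_equiv hk e) (ne_top_of_equiv hk e) d).1 hd.le
      change pdimQuotient J ≤ pdimQuotient I
      rw [hd, pdimQuotient_le_iff (ne_bot_of_equiv hk e') (ne_top_of_equiv hk e')]
      exact ⟨q, hq, hasProjectiveDimensionLT_ideal_of_preimage hθ hI hJ hIJ h⟩)
  exact ⟨F₁, F₂, F₃, F₄, fun L n I hI => ⟨h₁ L n I hI, h₂ L n I hI, h₃ L n I hI, h₄ L n I hI⟩,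
    hm₁, hm₂, hm₃, hm₄⟩
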